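/- Encode instances and solutions of search problems as bit strings; a search problem is a binary relation "$y$ is a solution of $x$" on bit strings. A search problem $R$ *reduces* to a search problem $S$ if there are polynomial-time computable functions $f,g$ such that for every instance $x$ of $R$ and every solution $y$ of the instance $f(x)$ of $S$, $g(x,y)$ is a solution of $x$. **Empty.** Given $n\ge 2$ and a Boolean circuit $C$ with $n$ inputs and $n$ outputs, viewed as a map $C:[2^n-2]\to[2^n-1]$, where $[N]$ is the set of the $N$ smallest $n$-bit numbers $0,\dots,N-1$ (should $C$ take the remaining $n$-bit value $2^n-1$, this is allowed), find $e\in[2^n-1]$ such that $C(i)\ne e$ for all $i\in[2^n-2]$. PEPP is the class of search problems that reduce to Empty. A search problem is *PEPP-hard* if every problem in PEPP reduces to it. **Short Choice.** Let $n\ge 2$ and let $U=[2^n-2]$, each object being represented by its $n$-bit string. Given are predicates $P_0,\dots,P_{n-2}$, $P_i:U^{i+2}\to\{0,1\}$, represented by Boolean circuits. (The input size is at least $n$ and the circuits are written out in the input, so running times are measured in $n$ and the circuit sizes.) A sequence $a_0,\dots,a_k$ $(k\ge 0)$ of distinct objects of $U$ is a *Long Choice subcertificate* if for each $i\in\{0,\dots,n-2\}$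 the value $P_i(a_0,\dots,a_i,a_j)$ is the same for all $j$ with $i<j\le k$. The problem is to find a Long Choice subcertificate $a_0,\dots,a_k$ with $k\le n-2$ and a bit $c$ such that there is no $x\in U$ for which $a_0,\dots,a_k,x$ is a Long Choice subcertificate and $P_k(a_0,\dots,a_k,x)=c$. **Theorem.** Short Choice is PEPP-hard. -/

import Mathlib

namespace ShortChoice

/-! ### Search problems and polynomial-time reductions -/

/-- A search problem is a binary relation on bit strings: `R x y` says that `y` is a solution of
the instance `x`. -/
abbrev SearchProblem : Type := List Bool → List Bool → Prop

/-- `f` is computed by a (multi-stack) Turing machine whose number of steps is bounded by a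
polynomial in the length of its input. -/
def PolyTime (f : List Bool → List Bool) : Prop :=
  Nonempty (Turing.TM2ComputableInPolyTime (id : List Bool → List Bool)
    (id : List Bool → List Bool) f)

/-- The pair of two bit strings as one bit string: every bit of `x` is preceded by a `1`, then a
`0` marks the end of `x`, then comes `y`. -/
def pair (x y : List Bool) : List Bool :=
  x.flatMap (fun b => [true, b]) ++ false :: y

/-- `R` reduces to `S`: a polynomial-time function `f` maps instances of `R` to instances of `S`,
and a polynomial-time function `g` maps `x` and any solution of `f x` to a solution of `x`. -/
def Reduces (R S : SearchProblem) : Prop :=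
  ∃ f g : List Bool → List Bool, PolyTime f ∧ PolyTime g ∧
    ∀ x y : List Bool, S (f x) y → R x (g (pair x y))

/-! ### Boolean circuits -/

/-- A gate: a Boolean function of two bits, given by its truth table, together with the numbers of
the two wires that it reads. -/
structure Gate where
  /-- value at `(0, 0)` -/
  t00 : Bool
  /-- value at `(0, 1)` -/
  t01 : Bool
  /-- value at `(1, 0)` -/
  t10 : Bool
  /-- value at `(1, 1)` -/
  t11 : Bool
  /-- first wire -/
  fst : ℕ
  /-- second wire -/
  snd : ℕ

/-- The Boolean function computed by a gate. -/
def Gate.fn (g : Gate) (a b : Bool) : Bool :=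
  match a, b with
  | false, false => g.t00
  | false, true => g.t01
  | true, false => g.t10
  | true, true => g.t11

/-- A Boolean circuit over the full binary basis: its gates in topological order, and the numbers
of its output wires. In a circuit with `m` inputs the wires `0, …, m - 1` are the inputs, and wire
`m + k` is the output of the `k`-th gate. -/
structure Circuit where
  /-- the gates, in topological order -/
  gates : List Gate
  /-- the output wires -/
  outputs : List ℕ

/-- `C` is a circuit with `m` inputs and `p` outputs: every gate reads only inputs and earlier
gates, and the `p` outputs are existing wires. -/
def Circuit.IsCircuit (C : Circuit) (m p : ℕ) : Prop :=
  (∀ (k : ℕ) (g : Gate), C.gates[k]? = some g → g.fst < m + k ∧ g.snd < m + k) ∧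
  (∀ i ∈ C.outputs, i < m + C.gates.length) ∧
  C.outputs.length = p

/-- The values of all wires, obtained from the input bits by evaluating the gates in order. -/
def wires (gs : List Gate) (x : List Bool) : List Bool :=
  gs.foldl (fun w g => w ++ [g.fn (w.getD g.fst false) (w.getD g.snd false)]) x

/-- The output of a circuit on the input `x`. -/
def Circuit.eval (C : Circuit) (x : List Bool) : List Bool :=
  C.outputs.map (fun i => (wires C.gates x).getD i false)

/-! ### Encoding of circuits as bit strings

Numbers are written in unary, so a circuit with `m` inputs and `s` gates has a code of length
polynomial in `m`, `s` and the number of its outputs. -/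

/-- Unary code of a number. -/
def encNat (k : ℕ) : List Bool := List.replicate k true ++ [false]

/-- Code of a list: every entry is preceded by a `1`, and a `0` marks the end. -/
def encList {α : Type} (e : α → List Bool) (l : List α) : List Bool :=
  l.flatMap (fun a => true :: e a) ++ [false]

/-- Code of a gate. -/
def encGate (g : Gate) : List Bool :=
  [g.t00, g.t01, g.t10, g.t11] ++ encNat g.fst ++ encNat g.snd

/-- Code of a circuit. -/
def encCircuit (C : Circuit) : List Bool :=
  encList encGate C.gates ++ encList encNat C.outputs

/-! ### The problem Empty -/

/-- The number with binary representation `x` (least significant bit first). -/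
def val (x : List Bool) : ℕ := Nat.ofDigits 2 (x.map Bool.toNat)

/-- The set `[N] = {0, …, N - 1}`, each element represented by its `n`-bit string
(used for `N ≤ 2 ^ n`). -/
def bounded (n N : ℕ) : Set (List Bool) := {x | x.length = n ∧ val x < N}

/-- The code of the instance of Empty given by `n` and a circuit `C`. -/
def encEmpty (n : ℕ) (C : Circuit) : List Bool := encNat n ++ encCircuit C

/-- Empty: given a circuit `C` with `n ≥ 2` inputs and `n` outputs, regarded as a map defined on
`[2 ^ n - 2]`, find an element of `[2 ^ n - 1]` that is not a value of `C` on `[2 ^ n - 2]`.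
(On a string that is not an instance, every string counts as a solution.) -/
def Empty : SearchProblem := fun x y =>
  ∀ (n : ℕ) (C : Circuit), 2 ≤ n → C.IsCircuit n n → x = encEmpty n C →
    y ∈ bounded n (2 ^ n - 1) ∧ ∀ a ∈ bounded n (2 ^ n - 2), C.eval a ≠ y

/-- PEPP: the search problems that reduce to Empty. -/
def PEPP : Set SearchProblem := {R | Reduces R Empty}

/-- `S` is PEPP-hard: every problem in PEPP reduces to `S`. -/
def PEPPHard (S : SearchProblem) : Prop := ∀ R ∈ PEPP, Reduces R S

/-! ### The problem Short Choice -/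

/-- The universe of `2 ^ n - 2` objects. -/
def univ (n : ℕ) : Set (List Bool) := bounded n (2 ^ n - 2)

/-- The (one-bit) output of the predicate `P i` on a tuple of objects. -/
def predVal (P : List Circuit) (i : ℕ) (args : List (List Bool)) : List Bool :=
  (P.getD i ⟨[], []⟩).eval args.flatten

/-- `P` is a sequence `P 0, …, P (n - 2)` of predicates, `P i` being a circuit for a map
from `(i + 2)`-tuples of objects to bits. -/
def IsInstance (n : ℕ) (P : List Circuit) : Prop :=
  2 ≤ n ∧ P.length = n - 1 ∧
    ∀ (i : ℕ) (Q : Circuit), P[i]? = some Q → Q.IsCircuit ((i + 2) * n) 1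

/-- `as = [a 0, …, a k]` (with `k ≥ 0`) is a Long Choice subcertificate: the `a i` are distinct
objects of the universe, and for each `i` the value `P i (a 0, …, a i, a j)` is the same for all
`j > i`. -/
def IsSubcertificate (n : ℕ) (P : List Circuit) (as : List (List Bool)) : Prop :=
  as ≠ [] ∧ (∀ a ∈ as, a ∈ univ n) ∧ as.Nodup ∧
    ∀ i < n - 1, ∀ j j' : ℕ, ∀ b b' : List Bool, i < j → i < j' →
      as[j]? = some b → as[j']? = some b' →
        predVal P i (as.take (i + 1) ++ [b]) = predVal P i (as.take (i + 1) ++ [b'])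

/-- `as = [a 0, …, a k]` and the bit `c` form a Short Choice certificate: `k ≤ n - 2`, `as` is a
Long Choice subcertificate, and it cannot be extended to a Long Choice subcertificate
`a 0, …, a k, x` with `P k (a 0, …, a k, x) = c`. -/
def IsCertificate (n : ℕ) (P : List Circuit) (as : List (List Bool)) (c : Bool) : Prop :=
  IsSubcertificate n P as ∧ as.length ≤ n - 1 ∧
    ¬ ∃ x ∈ univ n, IsSubcertificate n P (as ++ [x]) ∧
      predVal P (as.length - 1) (as ++ [x]) = [c]

/-- The code of an instance of Short Choice. -/
def encInstance (n : ℕ) (P : List Circuit) : List Bool := encNat n ++ encList encCircuit P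

/-- Short Choice: given predicates `P 0, …, P (n - 2)`, find a certificate `(a 0, …, a k)`, `c`,
written as the bit `c` followed by the `n`-bit strings `a 0, …, a k`.
(On a string that is not an instance, every string counts as a solution.) -/
def Problem : SearchProblem := fun x y =>
  ∀ (n : ℕ) (P : List Circuit), IsInstance n P → x = encInstance n P →
    ∃ (as : List (List Bool)) (c : Bool), y = c :: as.flatten ∧ IsCertificate n P as c

/-! ### The codes are uniquely decodable -/

/-- A code is prefix-free if it can be read off from the front of a string. -/
def PrefixFree {α : Type} (e : α → List Bool) : Prop :=
  ∀ a b r s, e a ++ r = e b ++ s → a = b ∧ r = s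

theorem encNat_prefixFree : PrefixFree encNat := by
  intro a
  induction a with
  | zero => intro b r s h; cases b <;> simp_all [encNat, List.replicate_succ]
  | succ a ih =>
    intro b r s h
    cases b with
    | zero => simp [encNat, List.replicate_succ] at h
    | succ b =>
      have := ih b r s (by simpa [encNat, List.replicate_succ] using h)
      simp_all

theorem encList_prefixFree {α : Type} {e : α → List Bool} (he : PrefixFree e) :
    PrefixFree (encList e) := by
  intro l
  induction l with
  | nil => intro m r s h; cases m <;> simp_all [encList]
  | cons a l ih =>
    intro m r s h
    cases m with
    | nil => simp [encList] at h
    | cons b m =>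
      simp only [encList, List.flatMap_cons, List.append_assoc, List.cons_append,
        List.cons.injEq, true_and] at h
      obtain ⟨rfl, h⟩ := he _ _ _ _ h
      have := ih m r s (by simpa [encList] using h)
      simp_all

theorem encGate_prefixFree : PrefixFree encGate := by
  rintro ⟨a, b, c, d, i, j⟩ ⟨a', b', c', d', i', j'⟩ r s h
  simp only [encGate, List.append_assoc, List.cons_append, List.nil_append,
    List.cons.injEq] at h
  obtain ⟨rfl, rfl, rfl, rfl, h⟩ := h
  obtain ⟨h1, h2⟩ := encNat_prefixFree _ _ _ _ h
  obtain ⟨h3, h4⟩ := encNat_prefixFree _ _ _ _ h2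
  simp [h1, h3, h4]

theorem encCircuit_prefixFree : PrefixFree encCircuit := by
  rintro ⟨g, o⟩ ⟨g', o'⟩ r s h
  simp only [encCircuit, List.append_assoc] at h
  obtain ⟨h1, h2⟩ := encList_prefixFree encGate_prefixFree _ _ _ _ h
  obtain ⟨h3, h4⟩ := encList_prefixFree encNat_prefixFree _ _ _ _ h2
  simp [h1, h3, h4]

theorem encEmpty_injective {n n' : ℕ} {C C' : Circuit} (h : encEmpty n C = encEmpty n' C') :
    n = n' ∧ C = C' := by
  obtain ⟨h1, h2⟩ := encNat_prefixFree _ _ _ _ h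
  exact ⟨h1, (encCircuit_prefixFree _ _ [] [] (by simpa using h2)).1⟩

theorem encInstance_injective {n n' : ℕ} {P P' : List Circuit}
    (h : encInstance n P = encInstance n' P') : n = n' ∧ P = P' := by
  obtain ⟨h1, h2⟩ := encNat_prefixFree _ _ _ _ h
  exact ⟨h1, (encList_prefixFree encCircuit_prefixFree _ _ [] [] (by simpa using h2)).1⟩

end ShortChoice

/-! Reductions compose, so it suffices to reduce Empty to Short Choice. Give each object `x` of
`[2^n - 2]` the label `C(x)`. The admissible labels are the `2^n - 1` strings of length `n` other
than `1…1`. When `a_0` is chosen, its label `d` is removed and the label `01…1` (`pivot`) is renamed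
to `d`. From the admissible labels this leaves all strings except `01…1` and `1…1`. Those beginning
with `0` and those beginning with `1` are then equally many, and deleting the first bit turns either
half into the set of all strings of length `n - 1` other than `1…1`. The bit `P_0(a_0, x)` is the
deleted bit, and the same procedure on the shorter labels gives `P_1, P_2, …`. A `1` is appended for
each deleted bit, so labels keep length `n` and end in `k` ones after `k` rounds.

Each round can be undone: a bit and an admissible next label determine a previous label that is
admissible and different from the removed one (`prevLabel_spec`, iterated in `untrace_spec`). Given
a certificate `a_0, …, a_k`, `c`, prescribe in round `j < k` the bit `P_j(a_0, …, a_j, a_k)` and in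
round `k` the bit `c`, and go back from the label `0…01…1` with `k + 1` ones, which is admissible
because `k + 1 < n`. Let `e` be the initial label obtained. If `C(x) = e` for an object `x`, then
`x` avoids every removed label, hence differs from all `a_j`, and has exactly the prescribed bits.
So `a_0, …, a_k, x` would be a forbidden extension of the certificate. Hence `e` is not a value of
`C` (`solution_correct`).

The predicates are realised by circuits that hold copies of `C` and a table of the labels of all
objects in all rounds (`choiceCircuit_eval`). The remaining work is to show that both maps of the
reduction are polynomial-time on Turing machines. A small stack language with calls is compiled to
machines (`Run.reach`). From it come closure properties of polynomial-time functions (`PT.comp`,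
`PT.prodMk`, `PT.iterate`, `PT.foldl`), which are then applied to the definitions of the reduction
and to parsers of the codes. -/

namespace ShortChoice

/-! ### Compiling a stack language into Turing machines, with exact step counts. -/

open Turing Function

/-! ### Runs of a transition system -/

/-- `Reach f t a b`: the transition function `f` leads from `a` to `b` in exactly `t` steps. -/
def Reach {σ : Type} (f : σ → Option σ) (t : ℕ) (a b : σ) : Prop :=
  (flip bind f)^[t] (some a) = some b

namespace Reach

variable {σ : Type} {f : σ → Option σ} {a b c : σ} {s t : ℕ}

theorem refl (a : σ) : Reach f 0 a a := rfl

theorem head (h : f a = some b) (h' : Reach f t b c) : Reach f (t + 1) a c := by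
  have : flip bind f (some a) = some b := h
  unfold Reach
  rw [iterate_succ_apply, this]
  exact h'

theorem single (h : f a = some b) : Reach f 1 a b := head h (refl b)

theorem trans (h : Reach f s a b) (h' : Reach f t b c) : Reach f (s + t) a c := by
  unfold Reach at *
  rw [add_comm, iterate_add_apply, h, h']

theorem exists_of_succ (h : Reach f (t + 1) a c) : ∃ b, f a = some b ∧ Reach f t b c := by
  unfold Reach at *
  rw [iterate_succ_apply] at h
  have e : flip bind f (some a) = f a := rfl
  rw [e] at h
  cases hb : f a with
  | none =>
    exfalso
    have hn : ∀ n, (flip bind f)^[n] none = none := by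
      intro n
      induction n with
      | zero => rfl
      | succ n ih => rw [iterate_succ_apply]; exact ih
    rw [hb, hn] at h
    cases h
  | some b => exact ⟨b, rfl, by rw [hb] at h; exact h⟩

end Reach

/-! ### A structured language over stacks, with calls to machines -/

/-- Commands over the variables `V`, each of which holds a bit string, and the machines `I`. -/
inductive Cmd (V I : Type) : Type
  /-- do nothing -/
  | skip
  /-- push a bit -/
  | push (v : V) (b : Bool)
  /-- drop the first bit -/
  | pop (v : V)
  /-- sequential composition -/
  | seq (c d : Cmd V I)
  /-- branch on the first bit: none, `true`, `false` -/
  | case (v : V) (c d e : Cmd V I)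
  /-- repeat while the variable is nonempty -/
  | loop (v : V) (c : Cmd V I)
  /-- apply a machine to the reversed string, store the reversed output -/
  | call (i : I) (v : V)

variable {V I : Type}

/-- A machine maps `l` to `l'` in exactly `t` steps. -/
def Outputs (A : TM2ComputableAux Bool Bool) (l l' : List Bool) (t : ℕ) : Prop :=
  Reach A.tm.step t (initList A.tm (l.map A.inputAlphabet.invFun))
    (haltList A.tm (l'.map A.outputAlphabet.invFun))

/-- Big-step semantics with running time. -/
inductive Run [DecidableEq V] (A : I → TM2ComputableAux Bool Bool) :
    Cmd V I → (V → List Bool) → (V → List Bool) → ℕ → Prop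
  | skip (s) : Run A .skip s s 1
  | push (s v b) : Run A (.push v b) s (update s v (b :: s v)) 1
  | pop (s v) : Run A (.pop v) s (update s v (s v).tail) 1
  | seq {c d s s₁ s₂ t₁ t₂} : Run A c s s₁ t₁ → Run A d s₁ s₂ t₂ → Run A (.seq c d) s s₂ (t₁ + t₂)
  | case_nil {v c d e s s' t} : s v = [] → Run A c s s' t → Run A (.case v c d e) s s' (t + 1)
  | case_true {v c d e s s' t l} : s v = true :: l → Run A d s s' t →
      Run A (.case v c d e) s s' (t + 1)
  | case_false {v c d e s s' t l} : s v = false :: l → Run A e s s' t →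
      Run A (.case v c d e) s s' (t + 1)
  | loop_nil {v c s} : s v = [] → Run A (.loop v c) s s 1
  | loop_cons {v c s s₁ s₂ t₁ t₂ b l} : s v = b :: l → Run A c s s₁ t₁ →
      Run A (.loop v c) s₁ s₂ t₂ → Run A (.loop v c) s s₂ (t₁ + t₂ + 1)
  -- Transferring a string from one stack to another reverses it, on the way in and on the way out.
  -- The summands count feeding, the machine's own run and unloading; each `+ 1` is the step that
  -- finds the stack empty.
  | call {i v s l l' t} : s v = l.reverse → Outputs (A i) l l' t →
      Run A (.call i v) s (update s v l'.reverse) ((l.length + 1) + t + (l'.length + 1))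

variable (A : I → TM2ComputableAux Bool Bool)

/-- Labels of the compiled command. -/
@[reducible] def Cmd.Lab : Cmd V I → Type
  | .skip => Unit
  | .push _ _ => Unit
  | .pop _ => Unit
  | .seq c d => c.Lab ⊕ d.Lab
  | .case _ c d e => Unit ⊕ (c.Lab ⊕ (d.Lab ⊕ e.Lab))
  | .loop _ c => Unit ⊕ c.Lab
  | .call i _ => Bool ⊕ (A i).tm.Λ

instance Cmd.labFintype : (c : Cmd V I) → Fintype (c.Lab A)
  | .skip => inferInstanceAs (Fintype Unit)
  | .push _ _ => inferInstanceAs (Fintype Unit)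
  | .pop _ => inferInstanceAs (Fintype Unit)
  | .seq c d =>
    letI := labFintype c
    letI := labFintype d
    inferInstanceAs (Fintype (c.Lab A ⊕ d.Lab A))
  | .case _ c d e =>
    letI := labFintype c
    letI := labFintype d
    letI := labFintype e
    inferInstanceAs (Fintype (Unit ⊕ (c.Lab A ⊕ (d.Lab A ⊕ e.Lab A))))
  | .loop _ c =>
    letI := labFintype c
    inferInstanceAs (Fintype (Unit ⊕ c.Lab A))
  | .call i _ =>
    letI := (A i).tm.ΛFin
    inferInstanceAs (Fintype (Bool ⊕ (A i).tm.Λ))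

/-- The first label of the compiled command. -/
def Cmd.entry : (c : Cmd V I) → c.Lab A
  | .skip => ()
  | .push _ _ => ()
  | .pop _ => ()
  | .seq c _ => .inl c.entry
  | .case _ _ _ _ => .inl ()
  | .loop _ _ => .inl ()
  | .call _ _ => .inl false

variable (V) in
/-- Stacks of the compiled command: the variables and the stacks of the machines. -/
abbrev Stk : Type := V ⊕ (Σ i, (A i).tm.K)

/-- Stack alphabets of the compiled command. -/
abbrev Sym : Stk V A → Type
  | .inl _ => Bool
  | .inr p => (A p.1).tm.Γ p.2

/-- Control states of the compiled command. -/
abbrev Ctl : Type := Option Bool × ∀ i, (A i).tm.σ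

/-- The control state between two commands. -/
def rest : Ctl A := (none, fun i => (A i).tm.initialState)

/-- The stacks between two commands. -/
def stkOf (s : V → List Bool) : ∀ k : Stk V A, List (Sym A k)
  | .inl v => s v
  | .inr _ => []

variable {A}
variable {Λ : Type}

/-- A statement of a machine as a statement of the host; halting becomes a jump to `exit`. -/
def liftStmt [DecidableEq I] (i : I) (emb : (A i).tm.Λ → Λ) (exit : Λ) :
    TM2.Stmt (A i).tm.Γ (A i).tm.Λ (A i).tm.σ → TM2.Stmt (Sym (V := V) A) Λ (Ctl A)
  | .push k f q => .push (.inr ⟨i, k⟩) (fun c => f (c.2 i)) (liftStmt i emb exit q)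
  | .peek k f q => .peek (.inr ⟨i, k⟩) (fun c o => (c.1, update c.2 i (f (c.2 i) o)))
      (liftStmt i emb exit q)
  | .pop k f q => .pop (.inr ⟨i, k⟩) (fun c o => (c.1, update c.2 i (f (c.2 i) o)))
      (liftStmt i emb exit q)
  | .load f q => .load (fun c => (c.1, update c.2 i (f (c.2 i)))) (liftStmt i emb exit q)
  | .branch f q r => .branch (fun c => f (c.2 i)) (liftStmt i emb exit q) (liftStmt i emb exit r)
  | .goto l => .goto fun c => emb (l (c.2 i))
  | .halt => .goto fun _ => exit

/-- Clear the bit register. -/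
def clear (c : Ctl A) : Ctl A := (none, c.2)

/-- The statements of the compiled command, in a host with labels `Λ`. -/
def Cmd.code [DecidableEq I] : (c : Cmd V I) → (c.Lab A → Λ) → Λ → c.Lab A →
    TM2.Stmt (Sym (V := V) A) Λ (Ctl A)
  | .skip, _, exit, _ => .goto fun _ => exit
  | .push v b, _, exit, _ => .push (.inl v) (fun _ => b) (.goto fun _ => exit)
  | .pop v, _, exit, _ => .pop (.inl v) (fun c _ => c) (.goto fun _ => exit)
  | .seq c d, emb, _, .inl l =>
      c.code (fun l => emb (.inl l)) (emb (.inr (d.entry A))) l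
  | .seq _ d, emb, exit, .inr l => d.code (fun l => emb (.inr l)) exit l
  | .case v c d e, emb, _, .inl _ =>
      .peek (.inl v) (fun σ (o : Option Bool) => (o, σ.2)) <|
      .branch (fun σ => σ.1.isNone)
        (.load clear (.goto fun _ => emb (.inr (.inl (c.entry A))))) <|
      .branch (fun σ => σ.1.getD false)
        (.load clear (.goto fun _ => emb (.inr (.inr (.inl (d.entry A))))))
        (.load clear (.goto fun _ => emb (.inr (.inr (.inr (e.entry A))))))
  | .case _ c _ _, emb, exit, .inr (.inl l) => c.code (fun l => emb (.inr (.inl l))) exit l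
  | .case _ _ d _, emb, exit, .inr (.inr (.inl l)) =>
      d.code (fun l => emb (.inr (.inr (.inl l)))) exit l
  | .case _ _ _ e, emb, exit, .inr (.inr (.inr l)) =>
      e.code (fun l => emb (.inr (.inr (.inr l)))) exit l
  | .loop v c, emb, exit, .inl _ =>
      .peek (.inl v) (fun σ (o : Option Bool) => (o, σ.2)) <|
      .branch (fun σ => σ.1.isNone)
        (.load clear (.goto fun _ => exit))
        (.load clear (.goto fun _ => emb (.inr (c.entry A))))
  | .loop _ c, emb, _, .inr l => c.code (fun l => emb (.inr l)) (emb (.inl ())) l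
  | .call i v, emb, _, .inl false =>
      .pop (.inl v) (fun σ (o : Option Bool) => (o, σ.2)) <|
      .branch (fun σ => σ.1.isNone)
        (.load clear (.goto fun _ => emb (.inr (A i).tm.main)))
        (.push (.inr ⟨i, (A i).tm.k₀⟩) (fun σ => (A i).inputAlphabet.invFun (σ.1.getD false))
          (.load clear (.goto fun _ => emb (.inl false))))
  | .call i v, emb, exit, .inl true =>
      .pop (.inr ⟨i, (A i).tm.k₁⟩) (fun σ o => (o.map (A i).outputAlphabet, σ.2)) <|
      .branch (fun σ => σ.1.isNone)
        (.load clear (.goto fun _ => exit))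
        (.push (.inl v) (fun σ => (σ.1.getD false : Bool))
          (.load clear (.goto fun _ => emb (.inl true))))
  | .call i _, emb, _, .inr l => liftStmt i (fun l => emb (.inr l)) (emb (.inl true)) ((A i).tm.m l)

/-! ### Correctness of the compiler -/

variable [DecidableEq V] [DecidableEq I]

theorem update_stkOf_inl (s : V → List Bool) (v : V) (l : List Bool) :
    update (stkOf A s) (.inl v) l = stkOf A (update s v l) := by
  funext k
  rcases k with w | p
  · by_cases h : w = v
    · subst h; simp [stkOf]
    · simp [stkOf, h]
  · simp [stkOf]

/-- A lifted statement addresses only the stacks and the control component of machine `i`, so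
execution commutes with forgetting everything else. A missing next label, that is, halting, becomes
the label `exit`. -/
theorem liftStmt_stepAux (i : I) (emb : (A i).tm.Λ → Λ) (exit : Λ) (q) (σ : Ctl A) (T) :
    let c := TM2.stepAux q (σ.2 i) (fun k => T (.inr ⟨i, k⟩))
    let c' := TM2.stepAux (liftStmt (V := V) i emb exit q) σ T
    c'.l = some (c.l.elim exit emb) ∧ c'.var = (σ.1, update σ.2 i c.var) ∧
      (∀ k, c'.stk (.inr ⟨i, k⟩) = c.stk k) ∧ (∀ v, c'.stk (.inl v) = T (.inl v)) ∧
      ∀ j k, j ≠ i → c'.stk (.inr ⟨j, k⟩) = T (.inr ⟨j, k⟩) := by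
  have key : ∀ (T : ∀ k, List (Sym (V := V) A k)) (k : (A i).tm.K) (l : List ((A i).tm.Γ k)),
      (fun k' => update T (.inr ⟨i, k⟩) l (.inr ⟨i, k'⟩)) =
        update (fun k' => T (.inr ⟨i, k'⟩)) k l := by
    intro T k l
    funext k'
    by_cases h : k' = k
    · subst h; simp
    · rw [update_of_ne h, update_of_ne]
      simpa using h
  induction q generalizing σ T with
  | push k f q ih =>
    have := ih σ (update T (.inr ⟨i, k⟩) (f (σ.2 i) :: T (.inr ⟨i, k⟩)))
    rw [key] at this
    simpa +contextual [liftStmt] using this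
  | peek k f q ih =>
    have := ih (σ.1, update σ.2 i (f (σ.2 i) (T (.inr ⟨i, k⟩)).head?)) T
    simpa [liftStmt] using this
  | pop k f q ih =>
    have := ih (σ.1, update σ.2 i (f (σ.2 i) (T (.inr ⟨i, k⟩)).head?))
      (update T (.inr ⟨i, k⟩) (T (.inr ⟨i, k⟩)).tail)
    rw [key] at this
    simpa +contextual [liftStmt] using this
  | load f q ih =>
    have := ih (σ.1, update σ.2 i (f (σ.2 i))) T
    simpa [liftStmt] using this
  | branch f q r ihq ihr =>
    have h₁ := ihq σ T
    have h₂ := ihr σ T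
    simp only [liftStmt, TM2.stepAux]
    cases f (σ.2 i)
    · exact h₂
    · exact h₁
  | goto l => simp [liftStmt]
  | halt => simp [liftStmt]

/-- The jump that replaces halting is part of the same step, so host and machine take equally many
steps. -/
theorem liftStmt_reach {m : Λ → TM2.Stmt (Sym (V := V) A) Λ (Ctl A)} {i : I}
    {emb : (A i).tm.Λ → Λ} {exit : Λ} (hm : ∀ l, m (emb l) = liftStmt i emb exit ((A i).tm.m l))
    {t : ℕ} {c d : (A i).tm.Cfg} (h : Reach (A i).tm.step t c d) (hd : d.l = none)
    (o : Option Bool) (g : ∀ i, (A i).tm.σ) (T : ∀ k, List (Sym A k))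
    (hT : ∀ k, T (.inr ⟨i, k⟩) = c.stk k) :
    ∃ T', (∀ k, T' (.inr ⟨i, k⟩) = d.stk k) ∧ (∀ v, T' (.inl v) = T (.inl v)) ∧
      (∀ j k, j ≠ i → T' (.inr ⟨j, k⟩) = T (.inr ⟨j, k⟩)) ∧
      Reach (TM2.step m) t ⟨some (c.l.elim exit emb), (o, update g i c.var), T⟩
        ⟨some exit, (o, update g i d.var), T'⟩ := by
  induction t generalizing c T g with
  | zero =>
    obtain rfl : c = d := by simpa [Reach] using h
    refine ⟨T, hT, fun _ => rfl, fun _ _ _ => rfl, ?_⟩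
    rw [hd]
    exact Reach.refl _
  | succ t ih =>
    obtain ⟨b, hb, h⟩ := h.exists_of_succ
    obtain ⟨cl, cv, cs⟩ := c
    cases cl with
    | none => cases hb
    | some l =>
      replace hb : TM2.stepAux ((A i).tm.m l) cv cs = b := Option.some.inj hb
      obtain ⟨h1, h2, h3, h4, h5⟩ := liftStmt_stepAux (V := V) i emb exit ((A i).tm.m l)
        (o, update g i cv) T
      have e : (fun k => T (.inr ⟨i, k⟩)) = cs := funext hT
      simp only [update_self, e] at h1 h2 h3
      subst hb
      set c' := TM2.stepAux (liftStmt (V := V) i emb exit ((A i).tm.m l)) (o, update g i cv) T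
        with hc'
      obtain ⟨T', k1, k2, k3, k4⟩ := ih h g c'.stk h3
      refine ⟨T', k1, fun v => (k2 v).trans (h4 v), fun j k hj => (k3 j k hj).trans (h5 j k hj),
        Reach.head (b := c') ?_ ?_⟩
      · simp only [Option.elim, TM2.step, hm, hc']
      · convert k4 using 1
        obtain ⟨x, y, z⟩ := c'
        simp only at h1 h2
        simp only [TM2.Cfg.mk.injEq, and_true]
        exact ⟨h1, by rw [h2]; simp⟩

theorem call_feed {m : Λ → TM2.Stmt (Sym (V := V) A) Λ (Ctl A)} {i : I} {v : V}
    {emb : (Cmd.call (V := V) i v).Lab A → Λ} {exit : Λ}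
    (hm : ∀ l, m (emb l) = (Cmd.call i v).code emb exit l) (l : List Bool)
    (T : ∀ k, List (Sym A k)) (hT : T (.inl v) = l) :
    Reach (TM2.step m) (l.length + 1) ⟨some (emb (.inl false)), rest A, T⟩
      ⟨some (emb (.inr (A i).tm.main)), rest A,
        update (update T (.inl v) ([] : List Bool)) (.inr ⟨i, (A i).tm.k₀⟩)
          (l.reverse.map (A i).inputAlphabet.invFun ++ T (.inr ⟨i, (A i).tm.k₀⟩))⟩ := by
  induction l generalizing T with
  | nil =>
    apply Reach.single
    simp only [TM2.step, hm, Cmd.code, TM2.stepAux]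
    have e : (T (.inl v)).head? = none := by rw [hT]; rfl
    have e' : (T (.inl v)).tail = [] := by rw [hT]; rfl
    rw [e, e']
    simp [rest, clear]
  | cons b l ih =>
    refine Reach.head (b := ⟨some (emb (.inl false)), rest A, update (update T (.inl v) l)
      (.inr ⟨i, (A i).tm.k₀⟩) ((A i).inputAlphabet.invFun b :: T (.inr ⟨i, (A i).tm.k₀⟩))⟩) ?_ ?_
    · simp only [TM2.step, hm, Cmd.code, TM2.stepAux]
      have e : (T (.inl v)).head? = some b := by rw [hT]; rfl
      have e' : (T (.inl v)).tail = l := by rw [hT]; rfl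
      rw [e, e']
      simp [rest, clear]
    · have := ih (update (update T (.inl v) l)
        (.inr ⟨i, (A i).tm.k₀⟩) ((A i).inputAlphabet.invFun b :: T (.inr ⟨i, (A i).tm.k₀⟩)))
        (by simp)
      convert this using 2
      congr 1
      funext k
      rcases k with w | p
      · by_cases h : w = v
        · subst h; simp
        · simp [h]
      · by_cases h : p = ⟨i, (A i).tm.k₀⟩
        · subst h; simp
        · simp [h]

theorem call_unload {m : Λ → TM2.Stmt (Sym (V := V) A) Λ (Ctl A)} {i : I} {v : V}
    {emb : (Cmd.call (V := V) i v).Lab A → Λ} {exit : Λ}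
    (hm : ∀ l, m (emb l) = (Cmd.call i v).code emb exit l) (l : List Bool) (w : List Bool)
    (T : ∀ k, List (Sym A k)) (hw : T (.inl v) = w)
    (hT : T (.inr ⟨i, (A i).tm.k₁⟩) = l.map (A i).outputAlphabet.invFun) :
    Reach (TM2.step m) (l.length + 1) ⟨some (emb (.inl true)), rest A, T⟩
      ⟨some exit, rest A,
        update (update T (.inr ⟨i, (A i).tm.k₁⟩) []) (.inl v) (l.reverse ++ w : List Bool)⟩ := by
  induction l generalizing T w with
  | nil =>
    apply Reach.single
    simp only [TM2.step, hm, Cmd.code, TM2.stepAux]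
    have e : (T (.inr ⟨i, (A i).tm.k₁⟩)).head? = none := by rw [hT]; rfl
    have e' : (T (.inr ⟨i, (A i).tm.k₁⟩)).tail = [] := by rw [hT]; rfl
    rw [e, e']
    subst hw
    simp [rest, clear]
  | cons b l ih =>
    refine Reach.head (b := ⟨some (emb (.inl true)), rest A, update (update T
      (.inr ⟨i, (A i).tm.k₁⟩) (l.map (A i).outputAlphabet.invFun)) (.inl v)
        (b :: w : List Bool)⟩) ?_ ?_
    · simp only [TM2.step, hm, Cmd.code, TM2.stepAux]
      have e : (T (.inr ⟨i, (A i).tm.k₁⟩)).head? = some ((A i).outputAlphabet.invFun b) := by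
        rw [hT]; rfl
      have e' : (T (.inr ⟨i, (A i).tm.k₁⟩)).tail = l.map (A i).outputAlphabet.invFun := by
        rw [hT]; rfl
      rw [e, e']
      subst hw
      simp [rest, clear]
    · have := ih (b :: w) (update (update T
        (.inr ⟨i, (A i).tm.k₁⟩) (l.map (A i).outputAlphabet.invFun)) (.inl v)
        (b :: w : List Bool)) (by simp) (by simp)
      convert this using 2
      congr 1
      funext k
      rcases k with u | p
      · by_cases h : u = v
        · subst h; simp
        · simp [h]
      · by_cases h : p = ⟨i, (A i).tm.k₁⟩
        · subst h; simp
        · simp [h]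

/-- Any machine that contains the compiled command simulates its runs step by step. -/
theorem Run.reach {c : Cmd V I} {s s' : V → List Bool} {t : ℕ} (h : Run A c s s' t)
    {m : Λ → TM2.Stmt (Sym (V := V) A) Λ (Ctl A)} {emb : c.Lab A → Λ} {exit : Λ}
    (hm : ∀ l, m (emb l) = c.code emb exit l) :
    Reach (TM2.step m) t ⟨some (emb (c.entry A)), rest A, stkOf A s⟩
      ⟨some exit, rest A, stkOf A s'⟩ := by
  induction h generalizing exit with
  | skip s =>
    apply Reach.single
    simp [TM2.step, hm, Cmd.code]
  | push s v b =>
    apply Reach.single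
    simp [TM2.step, hm, Cmd.code, ← update_stkOf_inl]
    rfl
  | pop s v =>
    apply Reach.single
    simp [TM2.step, hm, Cmd.code, ← update_stkOf_inl]
    rfl
  | seq _ _ ih₁ ih₂ =>
    exact (ih₁ (emb := fun l => emb (.inl l)) fun l => hm (.inl l)).trans
      (ih₂ (emb := fun l => emb (.inr l)) fun l => hm (.inr l))
  | @case_nil v c d e s s' t hv _ ih =>
    refine Reach.head ?_ (ih (emb := fun l => emb (.inr (.inl l))) fun l => hm (.inr (.inl l)))
    simp only [Cmd.entry, TM2.step, hm, Cmd.code, TM2.stepAux, stkOf, hv]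
    rfl
  | @case_true v c d e s s' t l hv _ ih =>
    refine Reach.head ?_ (ih (emb := fun l => emb (.inr (.inr (.inl l))))
      fun l => hm (.inr (.inr (.inl l))))
    simp only [Cmd.entry, TM2.step, hm, Cmd.code, TM2.stepAux, stkOf, hv]
    rfl
  | @case_false v c d e s s' t l hv _ ih =>
    refine Reach.head ?_ (ih (emb := fun l => emb (.inr (.inr (.inr l))))
      fun l => hm (.inr (.inr (.inr l))))
    simp only [Cmd.entry, TM2.step, hm, Cmd.code, TM2.stepAux, stkOf, hv]
    rfl
  | @loop_nil v c s hv =>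
    apply Reach.single
    simp only [Cmd.entry, TM2.step, hm, Cmd.code, TM2.stepAux, stkOf, hv]
    rfl
  | @loop_cons v c s s₁ s₂ t₁ t₂ b l hv _ _ ih₁ ih₂ =>
    refine Reach.head ?_ ((ih₁ (emb := fun l => emb (.inr l)) (exit := emb (.inl ()))
      fun l => hm (.inr l)).trans (ih₂ (emb := emb) hm))
    simp only [Cmd.entry, TM2.step, hm, Cmd.code, TM2.stepAux, stkOf, hv]
    rfl
  | @call i v s l l' t hv hO =>
    have h₁ := call_feed hm (s v) (stkOf A s) rfl
    rw [hv, List.reverse_reverse, List.length_reverse] at h₁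
    obtain ⟨T', k₁, k₂, k₃, h₂⟩ := liftStmt_reach (V := V) (m := m)
      (emb := fun l => emb (.inr l)) (exit := emb (.inl true)) (fun l => hm (.inr l)) hO rfl none
      (fun i => (A i).tm.initialState)
      (update (update (stkOf A s) (.inl v) ([] : List Bool)) (.inr ⟨i, (A i).tm.k₀⟩)
          (l.map (A i).inputAlphabet.invFun ++ stkOf A s (.inr ⟨i, (A i).tm.k₀⟩))) (by
        intro k
        by_cases h : k = (A i).tm.k₀
        · subst h; simp [initList, stkOf]
        · simp [initList, stkOf, h])
    have h₃ := call_unload hm l' [] T' (by rw [k₂]; simp) (by rw [k₁]; simp [haltList])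
    -- `haltList` demands the initial control state and empty stacks apart from the output. Hence a
    -- finished call leaves the machine ready to be called again, and the host is back in `rest A`.
    have e₁ : ((none, update (fun i => (A i).tm.initialState) i
        (initList (A i).tm (l.map (A i).inputAlphabet.invFun)).var) : Ctl A) = rest A := by
      simp [initList, rest]
    have e₂ : ((none, update (fun i => (A i).tm.initialState) i
        (haltList (A i).tm (l'.map (A i).outputAlphabet.invFun)).var) : Ctl A) = rest A := by
      simp [haltList, rest]
    rw [e₁, e₂] at h₂
    refine cast ?_ ((h₁.trans h₂).trans h₃)
    congr 2
    funext k
    symm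
    rcases k with u | p
    · by_cases h : u = v
      · subst h; simp [stkOf]
      · simp [stkOf, h, k₂]
    · simp only [stkOf, ne_eq, reduceCtorEq, not_false_eq_true, update_of_ne]
      by_cases h : p = ⟨i, (A i).tm.k₁⟩
      · subst h; simp
      · rw [update_of_ne (by simpa using h)]
        obtain ⟨j, k⟩ := p
        by_cases hj : j = i
        · subst hj
          rw [k₁]
          have : k ≠ (A j).tm.k₁ := by rintro rfl; exact h rfl
          simp [haltList, this]
        · rw [k₃ j k hj, update_of_ne, update_of_ne] <;> simp [stkOf, hj]

/-! ### The compiled machine -/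

/-- The machine that runs a command, with input and output in given variables. -/
def Cmd.machine [Fintype V] [Fintype I] (A : I → TM2ComputableAux Bool Bool) (c : Cmd V I)
    (x y : V) : TM2ComputableAux Bool Bool where
  tm :=
    letI : ∀ i, Fintype (A i).tm.K := fun i => (A i).tm.kFin
    letI : ∀ i, Fintype (A i).tm.σ := fun i => (A i).tm.σFin
    { K := Stk V A
      k₀ := .inl x
      k₁ := .inl y
      Γ := Sym A
      Λ := Option (c.Lab A)
      main := some (c.entry A)
      σ := Ctl A
      initialState := rest A
      Γk₀Fin := inferInstanceAs (Fintype Bool)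
      m := fun l => l.elim .halt (c.code some none) }
  inputAlphabet := Equiv.refl Bool
  outputAlphabet := Equiv.refl Bool

/-- The state in which `x` holds `l` and all other variables are empty. -/
def only (x : V) (l : List Bool) : V → List Bool := update (fun _ => []) x l

theorem Run.outputs [Fintype V] [Fintype I] {c : Cmd V I} {x y : V} {l l' : List Bool} {t : ℕ}
    (h : Run A c (only x l) (only y l') t) : Outputs (c.machine A x y) l l' (t + 1) := by
  have h₁ := h.reach (m := (c.machine A x y).tm.m) (emb := some) (exit := none) fun _ => rfl
  have e₁ : initList (c.machine A x y).tm (l.map (c.machine A x y).inputAlphabet.invFun) =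
      ⟨some (some (c.entry A)), rest A, stkOf A (only x l)⟩ := by
    have : (stkOf A (only x l)) = fun k => (initList (c.machine A x y).tm
        (l.map (c.machine A x y).inputAlphabet.invFun)).stk k := by
      funext k
      rcases k with u | p
      · by_cases h : u = x
        · subst h; simp [stkOf, only, initList, Cmd.machine]; rfl
        · simp [stkOf, only, initList, Cmd.machine, h]
      · simp [stkOf, initList, Cmd.machine]
    rw [this]
    rfl
  have e₂ : haltList (c.machine A x y).tm (l'.map (c.machine A x y).outputAlphabet.invFun) =
      ⟨none, rest A, stkOf A (only y l')⟩ := by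
    have : (stkOf A (only y l')) = fun k => (haltList (c.machine A x y).tm
        (l'.map (c.machine A x y).outputAlphabet.invFun)).stk k := by
      funext k
      rcases k with u | p
      · by_cases h : u = y
        · subst h; simp [stkOf, only, haltList, Cmd.machine]; rfl
        · simp [stkOf, only, haltList, Cmd.machine, h]
      · simp [stkOf, haltList, Cmd.machine]
    rw [this]
    rfl
  unfold Outputs
  rw [e₁, e₂]
  -- The exit label `none` carries the statement `halt`; executing it is the additional step.
  exact Reach.trans h₁ (Reach.single rfl)

/-! ### The size of the output -/

/-- The number of pushes in a statement. -/
def pushes {K : Type} {Γ : K → Type} {Λ σ : Type} : TM2.Stmt Γ Λ σ → ℕ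
  | .push _ _ q => pushes q + 1
  | .peek _ _ q => pushes q
  | .pop _ _ q => pushes q
  | .load _ q => pushes q
  | .branch _ q r => pushes q + pushes r
  | .goto _ => 0
  | .halt => 0

theorem length_stepAux {K : Type} [DecidableEq K] {Γ : K → Type} {Λ σ : Type}
    (q : TM2.Stmt Γ Λ σ) (v : σ) (S : ∀ k, List (Γ k)) (B : ℕ) (h : ∀ k, (S k).length ≤ B) (k : K) :
    ((TM2.stepAux q v S).stk k).length ≤ B + pushes q := by
  induction q generalizing v S B with
  | push k' f q ih =>
    simp only [TM2.stepAux, pushes]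
    refine (ih _ _ (B + 1) fun j => ?_).trans (by omega)
    by_cases hj : j = k'
    · subst hj; simpa using h j
    · simpa [hj] using (h j).trans (by omega)
  | peek k' f q ih => exact ih _ _ _ h
  | pop k' f q ih =>
    refine ih _ _ _ fun j => ?_
    by_cases hj : j = k'
    · subst hj; simpa using (h j).trans (by omega)
    · simpa [hj] using h j
  | load f q ih => exact ih _ _ _ h
  | branch f q r ihq ihr =>
    simp only [TM2.stepAux, pushes]
    cases f v
    · exact (ihr _ _ _ h).trans (by omega)
    · exact (ihq _ _ _ h).trans (by omega)
  | goto l => simpa [pushes] using h k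
  | halt => simpa [pushes] using h k

/-- One step pushes at most as many symbols as its statement contains pushes, and there are finitely
many labels. This bounds the size of intermediate results by the running time, without which time
bounds could not be composed. -/
theorem Outputs.length_le (M : TM2ComputableAux Bool Bool) :
    ∃ D : ℕ, ∀ l l' t, Outputs M l l' t → l'.length ≤ l.length + D * t := by
  let _ := M.tm.ΛFin
  refine ⟨∑ l, pushes (M.tm.m l), fun l l' t h => ?_⟩
  have key : ∀ (t : ℕ) (c d : M.tm.Cfg) (B : ℕ), Reach M.tm.step t c d →
      (∀ k, (c.stk k).length ≤ B) → ∀ k, (d.stk k).length ≤ B + (∑ l, pushes (M.tm.m l)) * t := by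
    intro t
    induction t with
    | zero =>
      intro c d B h hc k
      obtain rfl : c = d := by simpa [Reach] using h
      simpa using hc k
    | succ t ih =>
      intro c d B h hc k
      obtain ⟨b, hb, h'⟩ := h.exists_of_succ
      obtain ⟨cl, cv, cs⟩ := c
      cases cl with
      | none => cases hb
      | some a =>
        replace hb : TM2.stepAux (M.tm.m a) cv cs = b := Option.some.inj hb
        have := ih b d (B + ∑ l, pushes (M.tm.m l)) h' (fun k => by
          rw [← hb]
          refine (length_stepAux _ _ _ B hc k).trans ?_
          have := Finset.single_le_sum (f := fun l => pushes (M.tm.m l)) (fun _ _ => Nat.zero_le _)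
            (Finset.mem_univ a)
          simpa using this) k
        refine this.trans (le_of_eq (by ring))
  have := key t _ _ l.length h (fun k => by
    by_cases hk : k = M.tm.k₀
    · subst hk; simp [initList]
    · simp [initList, hk]) M.tm.k₁
  simpa [haltList] using this

end ShortChoice

/-! ### A calculus of polynomial-time functions between encoded types. -/

namespace ShortChoice

open Turing Function Polynomial

/-! ### Functions computable in polynomial time between encoded types -/

/-- A type with an encoding by bit strings. -/
class Enc (α : Type) where
  /-- the code of an element -/
  enc : α → List Bool

open Enc (enc)

variable {α β γ δ : Type} [Enc α] [Enc β] [Enc γ] [Enc δ]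

/-- The function `f` is computed on codes by a machine in polynomial time. -/
@[fun_prop]
def PT (f : α → β) : Prop :=
  ∃ (M : TM2ComputableAux Bool Bool) (p : ℕ[X]), ∀ a, ∃ t ≤ p.eval (enc a).length,
    Outputs M (enc a) (enc (f a)) t

theorem eval_mono (p : ℕ[X]) {m n : ℕ} (h : m ≤ n) : p.eval m ≤ p.eval n := by
  rw [eval_eq_sum, eval_eq_sum]
  exact Finset.sum_le_sum fun i _ => Nat.mul_le_mul_left _ (Nat.pow_le_pow_left h _)

theorem PT.size {f : α → β} (hf : PT f) :
    ∃ p : ℕ[X], ∀ a, (enc (f a)).length ≤ p.eval (enc a).length := by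
  obtain ⟨M, p, h⟩ := hf
  obtain ⟨D, hD⟩ := Outputs.length_le M
  refine ⟨X + C D * p, fun a => ?_⟩
  obtain ⟨t, ht, h⟩ := h a
  simpa using (hD _ _ _ h).trans (Nat.add_le_add_left (Nat.mul_le_mul_left D ht) _)

/-! ### Running times up to an upper bound -/

/-- The command `c` leads from `s` to `s'` in at most `n` steps. -/
def Within {V I : Type} [DecidableEq V] (A : I → TM2ComputableAux Bool Bool) (c : Cmd V I)
    (s s' : V → List Bool) (n : ℕ) : Prop := ∃ t ≤ n, Run A c s s' t

namespace Within

variable {V I : Type} [DecidableEq V] {A : I → TM2ComputableAux Bool Bool} {c d e : Cmd V I}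
  {s s₁ s₂ : V → List Bool} {m n : ℕ} {v w : V} {b : Bool} {l : List Bool}

theorem mono (h : Within A c s s₁ m) (hm : m ≤ n) : Within A c s s₁ n :=
  let ⟨t, ht, h⟩ := h
  ⟨t, ht.trans hm, h⟩

theorem skip : Within A .skip s s 1 := ⟨1, le_rfl, .skip s⟩

theorem push (h : update s v (b :: s v) = s₁) : Within A (.push v b) s s₁ 1 :=
  ⟨1, le_rfl, h ▸ .push s v b⟩

theorem pop (h : update s v (s v).tail = s₁) : Within A (.pop v) s s₁ 1 :=
  ⟨1, le_rfl, h ▸ .pop s v⟩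

theorem seq (h : Within A c s s₁ m) (h' : Within A d s₁ s₂ n) :
    Within A (.seq c d) s s₂ (m + n) :=
  let ⟨_, ht, h⟩ := h
  let ⟨_, ht', h'⟩ := h'
  ⟨_, Nat.add_le_add ht ht', .seq h h'⟩

theorem case_nil (hv : s v = []) (h : Within A c s s₁ n) : Within A (.case v c d e) s s₁ (n + 1) :=
  let ⟨_, ht, h⟩ := h
  ⟨_, Nat.add_le_add_right ht 1, .case_nil hv h⟩

theorem case_true (hv : s v = true :: l) (h : Within A d s s₁ n) :
    Within A (.case v c d e) s s₁ (n + 1) :=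
  let ⟨_, ht, h⟩ := h
  ⟨_, Nat.add_le_add_right ht 1, .case_true hv h⟩

theorem case_false (hv : s v = false :: l) (h : Within A e s s₁ n) :
    Within A (.case v c d e) s s₁ (n + 1) :=
  let ⟨_, ht, h⟩ := h
  ⟨_, Nat.add_le_add_right ht 1, .case_false hv h⟩

theorem loop_nil (hv : s v = []) : Within A (.loop v c) s s 1 := ⟨1, le_rfl, .loop_nil hv⟩

theorem loop_cons (hv : s v = b :: l) (h : Within A c s s₁ m)
    (h' : Within A (.loop v c) s₁ s₂ n) : Within A (.loop v c) s s₂ (m + n + 1) :=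
  let ⟨_, ht, h⟩ := h
  let ⟨_, ht', h'⟩ := h'
  ⟨_, Nat.add_le_add_right (Nat.add_le_add ht ht') 1, .loop_cons hv h h'⟩

end Within

/-! ### Basic programs -/

/-- The state of three variables. -/
def st (x y z : List Bool) : Fin 3 → List Bool := ![x, y, z]

section St

variable (x y z l : List Bool)

@[simp] theorem st_zero : st x y z 0 = x := rfl
@[simp] theorem st_one : st x y z 1 = y := rfl
@[simp] theorem st_two : st x y z 2 = z := rfl
@[simp] theorem update_st_zero : update (st x y z) 0 l = st l y z := by
  funext i; fin_cases i <;> rfl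
@[simp] theorem update_st_one : update (st x y z) 1 l = st x l z := by
  funext i; fin_cases i <;> rfl
@[simp] theorem update_st_two : update (st x y z) 2 l = st x y l := by
  funext i; fin_cases i <;> rfl
theorem only_zero : only 0 l = st l [] [] := by funext i; fin_cases i <;> rfl
theorem only_one : only 1 l = st [] l [] := by funext i; fin_cases i <;> rfl
theorem only_two : only 2 l = st [] [] l := by funext i; fin_cases i <;> rfl

end St

/-- Programs with three variables and two machines. -/
abbrev Prog : Type := Cmd (Fin 3) Bool

theorem PT.of_prog {f : α → β} (A : Bool → TM2ComputableAux Bool Bool) (c : Prog) (y : Fin 3)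
    (p : ℕ[X])
    (h : ∀ a, Within A c (st (enc a) [] []) (only y (enc (f a))) (p.eval (enc a).length)) :
    PT f := by
  refine ⟨c.machine A 0 y, p + 1, fun a => ?_⟩
  obtain ⟨t, ht, h⟩ := h a
  rw [← only_zero] at h
  exact ⟨t + 1, by simpa using ht, h.outputs⟩

/-- Run `c true` or `c false` for every bit of `v`, from the first to the last. -/
def Cmd.each {V I : Type} (v : V) (c : Bool → Cmd V I) : Cmd V I :=
  .loop v (.case v .skip (.seq (.pop v) (c true)) (.seq (.pop v) (c false)))

/-- `S l acc` describes the state in which `l` is still to be read and `acc` has been accumulated.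
The overhead of 3 per bit consists of the loop test, the branching and the `pop`. -/
theorem Within.each {V I : Type} [DecidableEq V] {A : I → TM2ComputableAux Bool Bool} {v : V}
    {c : Bool → Cmd V I} (φ : Bool → List Bool) (S : List Bool → List Bool → V → List Bool) (N : ℕ)
    (hS : ∀ l acc, S l acc v = l)
    (hc : ∀ b l acc, Within A (c b) (update (S (b :: l) acc) v l) (S l (φ b ++ acc)) N)
    (l acc : List Bool) :
    Within A (Cmd.each v c) (S l acc) (S [] (l.foldl (fun acc b => φ b ++ acc) acc))
      ((N + 3) * l.length + 1) := by
  induction l generalizing acc with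
  | nil => exact loop_nil (hS [] acc)
  | cons b l ih =>
    refine (loop_cons (m := N + 2) (s₁ := S l (φ b ++ acc)) (hS (b :: l) acc) ?_ (ih _)).mono
      (by simp only [List.length_cons]; ring_nf; omega)
    cases b
    · refine (case_false (hS _ _) (seq (n := N) (pop rfl) ?_)).mono (by omega)
      simpa [hS] using hc false l acc
    · refine (case_true (hS _ _) (seq (n := N) (pop rfl) ?_)).mono (by omega)
      simpa [hS] using hc true l acc

/-- Move the contents of `v` to `w`, in reverse order. -/
def Cmd.move {V I : Type} (v w : V) : Cmd V I := .each v fun b => .push w b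

theorem foldl_push (φ : Bool → List Bool) (l acc : List Bool) :
    l.foldl (fun acc b => φ b ++ acc) acc = (l.flatMap fun b => (φ b).reverse).reverse ++ acc := by
  induction l generalizing acc with
  | nil => rfl
  | cons b l ih => simp [ih]

theorem Within.move {V I : Type} [DecidableEq V] {A : I → TM2ComputableAux Bool Bool} {v w : V}
    (hvw : v ≠ w) {s s' : V → List Bool}
    (h : update (update s w ((s v).reverse ++ s w)) v [] = s') :
    Within A (Cmd.move v w) s s' (4 * (s v).length + 1) := by
  have := Within.each (A := A) (v := v) (c := fun b => Cmd.push w b) (N := 1) (fun b => [b])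
    (fun l acc => update (update s w acc) v l) (by simp) (fun b l acc => by
      refine Within.push ?_
      simp only [ne_eq, hvw.symm, not_false_eq_true, update_of_ne, update_self, update_idem]
      rw [update_comm hvw, update_idem]; simp) (s v) (s w)
  rw [foldl_push] at this
  rw [← h]
  simpa [Cmd.move] using this

/-- Clear a variable. -/
def Cmd.erase {V I : Type} (v : V) : Cmd V I := .each v fun _ => .skip

theorem Within.erase {V I : Type} [DecidableEq V] {A : I → TM2ComputableAux Bool Bool} {v : V}
    {s s' : V → List Bool} (h : update s v [] = s') :
    Within A (Cmd.erase v) s s' (4 * (s v).length + 1) := by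
  have := Within.each (A := A) (v := v) (c := fun b => Cmd.skip) (N := 1) (fun b => [])
    (fun l acc => update s v l) (by simp) (fun b l acc => by
      simpa using Within.skip) (s v) []
  rw [← h]
  simpa [Cmd.erase] using this

/-- Apply the machine `i` to the variable `v`, with a temporary variable `w`. -/
def Cmd.app {V I : Type} (i : I) (v w : V) : Cmd V I :=
  .seq (.move v w) (.seq (.call i w) (.move w v))

theorem Within.app {V I : Type} [DecidableEq V] {A : I → TM2ComputableAux Bool Bool} {v w : V}
    {i : I} (hvw : v ≠ w) {s s' : V → List Bool} {l' : List Bool} {t n : ℕ}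
    (hO : Outputs (A i) (s v) l' t) (hw : s w = []) (hn : t ≤ n) (h : update s v l' = s') :
    Within A (Cmd.app i v w) s s' (5 * (s v).length + n + 5 * l'.length + 4) := by
  have e : update (update (update (update (update s w ((s v).reverse ++ s w)) v []) w l'.reverse) v
      ((l'.reverse).reverse ++ [])) w [] = s' := by
    subst h
    funext k
    by_cases hk : k = w
    · subst hk; simp [hw, hvw.symm]
    · by_cases hk' : k = v
      · subst hk'; simp [hk]
      · simp [hk, hk']
  refine (seq (move hvw rfl) (seq (m := (s v).length + 1 + t + (l'.length + 1))
    ⟨_, le_rfl, .call (l := s v) ?_ hO⟩ (move hvw.symm (s' := s') ?_))).mono ?_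
  · simp [hvw.symm, hw]
  · rw [← e]; simp [hvw]
  · simp only [update_self, List.length_reverse]
    omega

/-- Push a string. -/
def Cmd.pushAll {V I : Type} (v : V) : List Bool → Cmd V I
  | [] => .skip
  | b :: l => .seq (pushAll v l) (.push v b)

theorem Within.pushAll {V I : Type} [DecidableEq V] {A : I → TM2ComputableAux Bool Bool} {v : V}
    (l : List Bool) {s s' : V → List Bool} (h : update s v (l ++ s v) = s') :
    Within A (Cmd.pushAll v l) s s' (l.length + 1) := by
  induction l generalizing s' with
  | nil => subst h; simpa [Cmd.pushAll] using skip
  | cons b l ih => exact seq (ih rfl) (push (by simpa using h))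

/-! ### Composition and basic functions -/

-- By `PT.size` the intermediate result has polynomial length, and polynomials over `ℕ` are
-- monotone, so the time of the second machine is bounded by a composed polynomial.
@[fun_prop]
theorem PT.comp {g : β → γ} {f : α → β} (hg : PT g) (hf : PT f) : PT fun a => g (f a) := by
  obtain ⟨q, hq⟩ := hg.size
  obtain ⟨r, hr⟩ := hf.size
  obtain ⟨M, p, hM⟩ := hf
  obtain ⟨N, p', hN⟩ := hg
  refine PT.of_prog (fun b => cond b M N) (.seq (.app true 0 1) (.app false 0 1)) 0
    (5 * X + p + 5 * r + 4 + (5 * r + p'.comp r + 5 * q.comp r + 4)) fun a => ?_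
  obtain ⟨t, ht, h⟩ := hM a
  obtain ⟨t', ht', h'⟩ := hN (f a)
  have e₁ := hr a
  have e₂ := (hq (f a)).trans (eval_mono q e₁)
  have e₃ := ht'.trans (eval_mono p' e₁)
  rw [only_zero]
  refine (Within.seq (Within.app (by decide) (n := t) h rfl le_rfl (update_st_zero ..))
    (Within.app (by decide) (n := t') h' rfl le_rfl (update_st_zero ..))).mono ?_
  simp [eval_comp]
  omega

/-- Bit strings, encoded by themselves. -/
def Str : Type := List Bool

instance : Enc Str := ⟨fun s => s⟩

/-- The first component of a pair of strings. -/
def fstStr : List Bool → List Bool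
  | true :: b :: l => b :: fstStr l
  | _ => []

/-- The second component of a pair of strings. -/
def sndStr : List Bool → List Bool
  | true :: _ :: l => sndStr l
  | false :: l => l
  | _ => []

theorem fstStr_pair (x y : List Bool) : fstStr (pair x y) = x := by
  induction x with
  | nil => rfl
  | cons b x ih => simpa [pair, fstStr] using ih

theorem sndStr_pair (x y : List Bool) : sndStr (pair x y) = y := by
  induction x with
  | nil => rfl
  | cons b x ih => simpa [pair, sndStr] using ih

theorem length_pair (x y : List Bool) : (pair x y).length = 2 * x.length + y.length + 1 := by
  induction x with
  | nil => simp [pair]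
  | cons b x ih =>
    simp only [pair, List.flatMap_cons, List.length_append, List.length_cons] at ih ⊢
    simp at ih ⊢
    omega

/-- Only the effect on codes matters. With `F` the identity this handles constructors whose code
coincides with that of their tuple of arguments. -/
theorem PT.of_str {f : α → β} {F : Str → Str} (hF : PT F) (h : ∀ a, enc (f a) = F (enc a)) :
    PT f := by
  obtain ⟨M, p, hM⟩ := hF
  refine ⟨M, p, fun a => ?_⟩
  rw [h]
  exact hM (enc a)

@[fun_prop]
theorem PT.id : PT fun a : α => a :=
  .of_prog (fun _ => default) .skip 0 1 fun a => by rw [only_zero]; simpa using Within.skip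

theorem PT.const_str (c : List Bool) : PT (α := Str) (β := Str) (fun _ => c) := by
  refine .of_prog (fun _ => default) (.seq (.erase 0) (.pushAll 0 c)) 0
    (4 * X + 1 + (C c.length + 1)) fun a => ?_
  rw [only_zero]
  refine (Within.seq (s₁ := st [] [] []) (Within.erase (by simp))
    (Within.pushAll (s' := st c [] []) c (by simp))).mono ?_
  simp

@[fun_prop]
theorem PT.const (b : β) : PT (fun _ => b : α → β) := .of_str (.const_str (enc b)) fun _ => rfl

theorem PT.cons_str (b : Bool) : PT (α := Str) (β := Str) (fun l => b :: l) := by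
  refine .of_prog (fun _ => default) (.push 0 b) 0 1 fun a => ?_
  rw [only_zero]
  exact (Within.push (update_st_zero ..)).mono (by simp)

theorem PT.tail_str : PT (α := Str) (β := Str) (fun l => List.tail l) := by
  refine .of_prog (fun _ => default) (.pop 0) 0 1 fun a => ?_
  rw [only_zero]
  exact (Within.pop (update_st_zero ..)).mono (by simp)

theorem PT.fst_str : PT (α := Str) (β := Str) (fstStr) := by
  refine .of_prog (fun _ => default) (.seq (.loop 0 (.case 0 .skip
    (.seq (.pop 0) (.case 0 .skip (.seq (.pop 0) (.push 1 true)) (.seq (.pop 0) (.push 1 false))))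
    (.erase 0))) (.move 1 2)) 2 (5 * X + 3 + (4 * X + 1)) fun a => ?_
  have key : ∀ (l acc : List Bool), Within (V := Fin 3) (I := Bool) (fun _ => default)
      (.loop 0 (.case 0 .skip
        (.seq (.pop 0)
          (.case 0 .skip (.seq (.pop 0) (.push 1 true)) (.seq (.pop 0) (.push 1 false))))
        (.erase 0))) (st l acc []) (st [] ((fstStr l).reverse ++ acc) []) (5 * l.length + 3) := by
    intro l acc
    induction l using fstStr.induct generalizing acc with
    | case1 b l ih =>
      have e : (fstStr (true :: b :: l)).reverse ++ acc = (fstStr l).reverse ++ b :: acc := by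
        simp [fstStr]
      rw [e]
      refine (Within.loop_cons (st_zero ..) (Within.case_true (st_zero ..)
        (Within.seq (Within.pop (update_st_zero ..)) (s₁ := st (b :: l) acc [])
          (s₂ := st l (b :: acc) []) (n := 3) ?_)) (ih _)).mono ?_
      · cases b
        · exact Within.case_false (st_zero ..) (Within.seq (Within.pop (update_st_zero ..))
            (Within.push (update_st_one ..)))
        · exact Within.case_true (st_zero ..) (Within.seq (Within.pop (update_st_zero ..))
            (Within.push (update_st_one ..)))
      · simp; omega
    | case2 l h =>
      match l, h with
      | [], _ => exact (Within.loop_nil rfl).mono (by simp)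
      | [true], _ =>
        exact (Within.loop_cons (st_zero ..) (Within.case_true (st_zero ..) (Within.seq
          (Within.pop (update_st_zero ..)) (Within.case_nil rfl Within.skip)))
            (Within.loop_nil rfl)).mono (by simp)
      | true :: b :: l, h => exact (h b l rfl).elim
      | false :: l, _ =>
        refine (Within.loop_cons (s₁ := st [] acc []) (st_zero ..)
          (Within.case_false (st_zero ..) (Within.erase (by simp)))
          (Within.loop_nil rfl)).mono ?_
        simp only [st_zero, List.length_cons]
        omega
  rw [only_two]
  have hl : ∀ l, (fstStr l).length ≤ l.length := by
    intro l
    induction l using fstStr.induct with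
    | case1 b l ih => simp [fstStr]; omega
    | case2 l => simp [fstStr]
  refine (Within.seq (key (enc a) []) (Within.move (by decide)
    (s' := st [] [] (fstStr a)) (by simp [enc]))).mono ?_
  have := hl a
  simp [enc]
  omega

theorem PT.snd_str : PT (α := Str) (β := Str) (sndStr) := by
  refine .of_prog (fun _ => default) (.seq (.loop 0 (.case 0 .skip
    (.seq (.pop 0) (.pop 0)) (.seq (.pop 0) (.move 0 1)))) (.move 1 2)) 2
      (4 * X + 5 + (4 * X + 1)) fun a => ?_
  have key : ∀ (l : List Bool), Within (V := Fin 3) (I := Bool) (fun _ => default)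
      (.loop 0 (.case 0 .skip (.seq (.pop 0) (.pop 0)) (.seq (.pop 0) (.move 0 1))))
        (st l [] []) (st [] (sndStr l).reverse []) (4 * l.length + 5) := by
    intro l
    induction l using sndStr.induct with
    | case1 b l ih =>
      exact (Within.loop_cons (st_zero ..) (Within.case_true (st_zero ..)
        (Within.seq (Within.pop (update_st_zero ..)) (Within.pop (update_st_zero ..)))) ih).mono
          (by simp; omega)
    | case2 l =>
      exact (Within.loop_cons (st_zero ..) (Within.case_false (st_zero ..)
        (Within.seq (Within.pop (update_st_zero ..)) (Within.move (by decide)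
          (s' := st [] l.reverse []) (by simp))))
          (Within.loop_nil rfl)).mono (by simp; omega)
    | case3 l h h' =>
      match l, h, h' with
      | [], _, _ => exact (Within.loop_nil rfl).mono (by simp)
      | [true], _, _ =>
        exact (Within.loop_cons (st_zero ..) (Within.case_true (st_zero ..) (Within.seq
          (Within.pop (update_st_zero ..)) (Within.pop (update_st_zero ..))))
            (Within.loop_nil rfl)).mono (by simp)
      | true :: b :: l, h, _ => exact (h b l rfl).elim
      | false :: l, _, h => exact (h l rfl).elim
  rw [only_two]
  have hl : ∀ l, (sndStr l).length ≤ l.length := by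
    intro l
    induction l using sndStr.induct with
    | case1 b l ih => simp [sndStr]; omega
    | case2 l => simp [sndStr]
    | case3 l => simp [sndStr]
  refine (Within.seq (key (enc a)) (Within.move (by decide)
    (s' := st [] [] (sndStr a)) (by simp [enc]))).mono ?_
  have := hl a
  simp [enc]
  omega

/-! ### Pairs -/

instance : Enc (α × β) := ⟨fun p => pair (enc p.1) (enc p.2)⟩

theorem enc_prod (p : α × β) : enc p = pair (enc p.1) (enc p.2) := rfl

theorem PT.fst' : PT (Prod.fst : α × β → α) :=
  .of_str .fst_str fun _ => (fstStr_pair _ _).symm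

theorem PT.snd' : PT (Prod.snd : α × β → β) :=
  .of_str .snd_str fun _ => (sndStr_pair _ _).symm

@[fun_prop]
theorem PT.fst {f : α → β × γ} (hf : PT f) : PT fun a => (f a).1 := PT.fst'.comp hf

@[fun_prop]
theorem PT.snd {f : α → β × γ} (hf : PT f) : PT fun a => (f a).2 := PT.snd'.comp hf

@[fun_prop]
theorem PT.prodMk {f : α → β} {g : α → γ} (hf : PT f) (hg : PT g) : PT fun a => (f a, g a) := by
  obtain ⟨q, hq⟩ := hf.size
  obtain ⟨r, hr⟩ := hg.size
  obtain ⟨M, p, hM⟩ := hf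
  obtain ⟨N, p', hN⟩ := hg
  -- The input, reversed in variable 1, is copied in its original order to variables 0 and 2, where
  -- `M` and `N` run separately. The first result is then put, each bit preceded by `true`, in front
  -- of `false` and the second result.
  refine PT.of_prog (fun b => cond b M N) (.seq (.move 0 1) <|
    .seq (.each 1 fun b => .seq (.push 0 b) (.push 2 b)) <| .seq (.app true 0 1) <|
    .seq (.app false 2 1) <| .seq (.push 2 false) <| .seq (.move 0 1) <|
    .each 1 fun b => .seq (.push 2 b) (.push 2 true)) 2
    (4 * X + 1 + (5 * X + 1 + (5 * X + p + 5 * q + 4 + (5 * X + p' + 5 * r + 4 + (1 +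
      (4 * q + 1 + (5 * q + 1))))))) fun a => ?_
  obtain ⟨t, ht, h⟩ := hM a
  obtain ⟨t', ht', h'⟩ := hN a
  have e₁ := hq a
  have e₂ := hr a
  rw [only_two]
  refine (Within.seq (s₁ := st [] (enc a).reverse []) (Within.move (by decide) (by simp)) <|
    Within.seq (s₁ := st (enc a) [] (enc a)) (m := 5 * (enc a).length + 1) ?_ <|
    Within.seq (Within.app (by decide) (n := t) h rfl le_rfl (update_st_zero ..)) <|
    Within.seq (Within.app (by decide) (n := t') h' rfl le_rfl (update_st_two ..)) <|
    Within.seq (Within.push (update_st_two ..)) <|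
    Within.seq (s₁ := st [] (enc (f a)).reverse (false :: enc (g a)))
      (Within.move (by decide) (by simp)) (n := 5 * (enc (f a)).length + 1) ?_).mono ?_
  · have := Within.each (A := fun b => cond b M N) (v := (1 : Fin 3))
      (c := fun b => .seq (.push 0 b) (.push 2 b)) (fun b => [b])
      (fun l acc => st acc l acc) 2 (by simp) (fun b l acc => Within.seq
        (Within.push rfl) (Within.push (by simp))) (enc a).reverse []
    rw [foldl_push] at this
    simpa using this
  · have := Within.each (A := fun b => cond b M N) (v := (1 : Fin 3))
      (c := fun b => .seq (.push 2 b) (.push 2 true)) (fun b => [true, b])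
      (fun l acc => st [] l acc) 2 (by simp) (fun b l acc => Within.seq
        (Within.push rfl) (Within.push (by simp))) (enc (f a)).reverse (false :: enc (g a))
    have e : ∀ (l acc : List Bool), l.reverse.foldl (fun acc b => [true, b] ++ acc) acc =
        (l.flatMap fun b => [true, b]) ++ acc := by
      intro l acc
      induction l generalizing acc with
      | nil => rfl
      | cons b l ih => simp [List.foldl_append] at ih ⊢; rw [ih]
    rw [e] at this
    simpa [enc_prod, pair] using this
  · simp
    omega

end ShortChoice

namespace ShortChoice

open Turing Function Polynomial
open Enc (enc)

variable {α β γ δ σ : Type} [Enc α] [Enc β] [Enc γ] [Enc δ] [Enc σ]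

/-! ### Encodings of Booleans, numbers and lists -/

instance : Enc Bool := ⟨fun b => [b]⟩
instance : Enc ℕ := ⟨fun n => List.replicate n true⟩
instance : Enc (List α) := ⟨fun l => l.flatMap fun a => pair (enc a) []⟩

theorem enc_nat (n : ℕ) : enc n = List.replicate n true := rfl
theorem enc_cons (a : α) (l : List α) : enc (a :: l) = pair (enc a) (enc l) := by
  simp [enc, pair]

@[simp] theorem length_enc_bool (b : Bool) : (enc b).length = 1 := rfl
@[simp] theorem length_enc_nat (n : ℕ) : (enc n).length = n := by simp [enc_nat]
@[simp] theorem length_enc_nil : (enc ([] : List α)).length = 0 := rfl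
@[simp] theorem length_enc_cons (a : α) (l : List α) :
    (enc (a :: l)).length = 2 * (enc a).length + (enc l).length + 1 := by
  rw [enc_cons, length_pair]
@[simp] theorem length_enc_prod (a : α) (b : β) :
    (enc (a, b)).length = 2 * (enc a).length + (enc b).length + 1 := by
  rw [enc_prod, length_pair]
@[simp] theorem length_enc_append (l m : List α) :
    (enc (l ++ m)).length = (enc l).length + (enc m).length := by
  simp [enc]

theorem length_le_enc (l : List α) : l.length ≤ (enc l).length := by
  induction l with
  | nil => simp
  | cons a l ih => simp; omega

theorem PT.of_eq {f g : α → β} (hf : PT f) (h : ∀ a, f a = g a) : PT g := funext h ▸ hf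

/-! ### Case distinction and iteration -/

@[fun_prop]
theorem PT.cond {c : α → Bool} {f g : α → β} (hc : PT c) (hf : PT f) (hg : PT g) :
    PT fun a => bif c a then f a else g a := by
  suffices h : PT fun p : Bool × α => bif p.1 then f p.2 else g p.2 from
    h.comp (hc.prodMk PT.id)
  obtain ⟨q, hq⟩ := hf.size
  obtain ⟨r, hr⟩ := hg.size
  obtain ⟨M, p, hM⟩ := hf
  obtain ⟨N, p', hN⟩ := hg
  refine PT.of_prog (fun b => bif b then M else N) (.seq (.pop 0) <| .case 0 .skip
    (.seq (.pop 0) (.seq (.pop 0) (.app true 0 1))) (.seq (.pop 0) (.seq (.pop 0) (.app false 0 1))))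
    0 (5 * X + p + 5 * q + 4 + (5 * X + p' + 5 * r + 4) + 4) fun a => ?_
  obtain ⟨b, a⟩ := a
  have e : enc (b, a) = true :: b :: false :: enc a := rfl
  have h₁ := hq a
  have h₂ := hr a
  have m := fun p : ℕ[X] => eval_mono p
    (show (enc a).length ≤ (true :: b :: false :: enc a).length by simp only [List.length_cons]; omega)
  have m₁ := m p
  have m₂ := m p'
  have m₃ := m q
  have m₄ := m r
  rw [only_zero, e]
  generalize hz : (true :: b :: false :: enc a).length = z at *
  simp only [List.length_cons] at hz
  cases b
  · obtain ⟨t, ht, h⟩ := hN a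
    refine (Within.seq (Within.pop (update_st_zero ..)) <| Within.case_false (st_zero ..) <|
      Within.seq (Within.pop (update_st_zero ..)) <| Within.seq (Within.pop (update_st_zero ..)) <|
        Within.app (by decide) (n := t) h rfl le_rfl (update_st_zero ..)).mono ?_
    simp
    omega
  · obtain ⟨t, ht, h⟩ := hM a
    refine (Within.seq (Within.pop (update_st_zero ..)) <| Within.case_true (st_zero ..) <|
      Within.seq (Within.pop (update_st_zero ..)) <| Within.seq (Within.pop (update_st_zero ..)) <|
        Within.app (by decide) (n := t) h rfl le_rfl (update_st_zero ..)).mono ?_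
    simp
    omega

/-- Iterating a polynomial-time map can produce exponential growth, so `hb` bounds all intermediate
results. The number of rounds is harmless because it is given in unary. -/
theorem PT.iterate {s : σ → σ} (hs : PT s) (b : ℕ[X])
    (hb : ∀ (n : ℕ) (x : σ), ∀ i ≤ n, (enc (s^[i] x)).length ≤ b.eval (enc (n, x)).length) :
    PT fun p : ℕ × σ => s^[p.1] p.2 := by
  obtain ⟨M, p, hM⟩ := hs
  refine PT.of_prog (fun _ => M) (.seq (.loop 0 (.case 0 .skip
    (.seq (.pop 0) (.seq (.pop 0) (.push 1 true))) (.seq (.pop 0) (.move 0 2)))) <|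
    .seq (.move 2 0) <| .loop 1 (.seq (.pop 1) (.app true 0 2))) 0
    ((5 * X + 5) + (4 * X + 1) + (X * (10 * b + p.comp b + 6) + 1)) fun a => ?_
  obtain ⟨n, x⟩ := a
  have k₁ : ∀ m k, Within (V := Fin 3) (I := Bool) (fun _ => M) (.loop 0 (.case 0 .skip
      (.seq (.pop 0) (.seq (.pop 0) (.push 1 true))) (.seq (.pop 0) (.move 0 2))))
      (st (pair (List.replicate m true) (enc x)) (List.replicate k true) [])
      (st [] (List.replicate (m + k) true) (enc x).reverse) (5 * m + 4 * (enc x).length + 5) := by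
    intro m
    induction m with
    | zero =>
      intro k
      have e : pair (List.replicate 0 true) (enc x) = false :: enc x := rfl
      rw [e, Nat.zero_add]
      refine (Within.loop_cons (st_zero ..) (Within.case_false (st_zero ..) (Within.seq
        (Within.pop (update_st_zero ..)) (Within.move (by decide)
          (s' := st [] (List.replicate k true) (enc x).reverse) (by simp))))
          (Within.loop_nil (st_zero ..))).mono ?_
      simp
      omega
    | succ m ih =>
      intro k
      have := ih (k + 1)
      rw [show m + (k + 1) = m + 1 + k by ring] at this
      refine (Within.loop_cons (s₁ := st (pair (List.replicate m true) (enc x))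
        (List.replicate (k + 1) true) []) (b := true) rfl (Within.case_true rfl (Within.seq
        (Within.pop rfl) (Within.seq (Within.pop rfl) (Within.push ?_)))) this).mono ?_
      · simp [pair, List.replicate_succ]
      · simp
        omega
  have k₂ : ∀ m i, m + i = n → Within (V := Fin 3) (I := Bool) (fun _ => M)
      (.loop 1 (.seq (.pop 1) (.app true 0 2))) (st (enc (s^[i] x)) (List.replicate m true) [])
      (st (enc (s^[n] x)) [] [])
      (m * (10 * b.eval (enc (n, x)).length + p.eval (b.eval (enc (n, x)).length) + 6) + 1) := by
    intro m
    induction m with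
    | zero =>
      intro i hi
      obtain rfl : i = n := by omega
      exact (Within.loop_nil rfl).mono (by simp)
    | succ m ih =>
      intro i hi
      have := ih (i + 1) (by omega)
      obtain ⟨t, ht, h⟩ := hM (s^[i] x)
      rw [← iterate_succ_apply' s] at h
      have e₁ := hb n x i (by omega)
      have e₂ := hb n x (i + 1) (by omega)
      have e₃ := eval_mono p e₁
      rw [List.replicate_succ]
      refine (Within.loop_cons (st_one ..) (Within.seq
        (Within.pop (update_st_one ..)) (Within.app (by decide) (n := t) h rfl le_rfl
          (update_st_zero ..))) this).mono ?_
      generalize hK : 10 * b.eval (enc (n, x)).length +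
        p.eval (b.eval (enc (n, x)).length) + 6 = K
      have e₄ : (m + 1) * K = m * K + K := by ring
      simp only [st_zero]
      omega
  rw [only_zero]
  have h₁ := k₁ n 0
  have h₂ := k₂ n 0 (by omega)
  refine (Within.seq h₁ (Within.seq (Within.move (by decide) (s' := st (enc x)
    (List.replicate n true) []) (by simp)) h₂)).mono ?_
  have hz : (enc (n, x)).length = 2 * n + (enc x).length + 1 := by simp
  generalize (enc (n, x)).length = z at *
  have h₃ := Nat.mul_le_mul_right (10 * b.eval z + p.eval (b.eval z) + 6) (show n ≤ z by omega)
  simp only [eval_add, eval_mul, eval_X, eval_comp, eval_one, eval_ofNat, st_two,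
    List.length_reverse] at h₃ ⊢
  omega

/-! ### Conversions of strings -/

theorem PT.isNil_str : PT (α := Str) (β := Bool) (fun l => List.isEmpty l) := by
  refine .of_prog (fun _ => default) (.case 0 (.push 0 true) (.seq (.erase 0) (.push 0 false))
    (.seq (.erase 0) (.push 0 false))) 0 (4 * X + 3) fun a => ?_
  rw [only_zero]
  obtain ⟨l, hl⟩ : ∃ l : List Bool, l = a := ⟨a, rfl⟩
  subst hl
  match l with
  | [] => exact (Within.case_nil rfl (Within.push (update_st_zero ..))).mono (by simp)
  | true :: l =>
    exact (Within.case_true (st_zero ..) (Within.seq (Within.erase (update_st_zero ..))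
      (Within.push (update_st_zero ..)))).mono (by
        change _ ≤ (4 * X + 3 : ℕ[X]).eval (true :: l).length; simp; omega)
  | false :: l =>
    exact (Within.case_false (st_zero ..) (Within.seq (Within.erase (update_st_zero ..))
      (Within.push (update_st_zero ..)))).mono (by
        change _ ≤ (4 * X + 3 : ℕ[X]).eval (false :: l).length; simp; omega)

theorem PT.orElse_str (d : List Bool) :
    PT (α := Str) (β := Str) (fun l => bif List.isEmpty l then d else l) :=
  PT.cond PT.isNil_str (PT.const_str d) PT.id

/-- The length of the code, a bound for the number of iterations. -/
def codeLength (a : α) : ℕ := (enc a).length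

@[fun_prop]
theorem PT.codeLength' : PT (codeLength : α → ℕ) := by
  refine .of_prog (fun _ => default) (.each 0 fun _ => .push 1 true) 1 (4 * X + 1) fun a => ?_
  rw [only_one]
  have := Within.each (A := fun _ : Bool => (default : TM2ComputableAux Bool Bool))
      (v := (0 : Fin 3)) (c := fun b => .push 1 true) (fun b => [true])
      (fun l acc => st l acc []) 1 (by simp) (fun b l acc => Within.push (by simp)) (enc a) []
  rw [foldl_push] at this
  refine cast ?_ this
  congr 2
  · simp [codeLength, enc_nat, List.flatMap_def, List.map_const']
  · simp

/-- A bit string as a list of Booleans. -/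
def Str.toList (s : Str) : List Bool := s

/-- A list of Booleans as a bit string. -/
def Str.ofList (l : List Bool) : Str := l

@[fun_prop]
theorem PT.str_toList : PT Str.toList := by
  refine .of_prog (fun _ => default) (.seq (.each 0 fun b => .seq (.push 1 true)
    (.seq (.push 1 b) (.push 1 false))) (.move 1 2)) 2 (6 * X + 1 + (12 * X + 1)) fun a => ?_
  rw [only_two]
  have := Within.each (A := fun _ : Bool => (default : TM2ComputableAux Bool Bool))
      (v := (0 : Fin 3)) (c := fun b => .seq (.push 1 true)
    (.seq (.push 1 b) (.push 1 false))) (fun b => [false, b, true])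
      (fun l acc => st l acc []) 3 (by simp) (fun b l acc => Within.seq (Within.push rfl)
        (Within.seq (Within.push rfl) (Within.push (by simp)))) (enc a) []
  rw [foldl_push] at this
  have e : enc (Str.toList a) = (enc a).flatMap fun b => [true, b, false] := rfl
  refine (Within.seq this (Within.move (by decide) (by rw [e]; simp))).mono ?_
  simp
  omega

@[fun_prop]
theorem PT.str_ofList : PT Str.ofList := by
  refine .of_prog (fun _ => default) (.seq (.loop 0 (.case 0 .skip (.seq (.pop 0)
    (.case 0 .skip (.seq (.push 1 true) (.seq (.pop 0) (.pop 0)))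
      (.seq (.push 1 false) (.seq (.pop 0) (.pop 0))))) .skip)) (.move 1 2)) 2
    (7 * X + 1 + (4 * X + 1)) fun a => ?_
  rw [only_two]
  have key : ∀ l acc : List Bool, Within (V := Fin 3) (I := Bool) (fun _ => default)
      (.loop 0 (.case 0 .skip (.seq (.pop 0)
    (.case 0 .skip (.seq (.push 1 true) (.seq (.pop 0) (.pop 0)))
      (.seq (.push 1 false) (.seq (.pop 0) (.pop 0))))) .skip)) (st (enc l) acc [])
      (st [] (l.reverse ++ acc) []) (7 * l.length + 1) := by
    intro l
    induction l with
    | nil => intro acc; exact Within.loop_nil rfl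
    | cons b l ih =>
      intro acc
      have e : enc (b :: l) = true :: b :: false :: enc l := rfl
      rw [e, List.reverse_cons, List.append_assoc]
      refine (Within.loop_cons (st_zero ..) (Within.case_true (st_zero ..) (Within.seq
        (Within.pop (update_st_zero ..)) (n := 4) (s₂ := st (enc l) (b :: acc) []) ?_)) (ih _)).mono
          (by simp; omega)
      cases b
      · exact Within.case_false (st_zero ..) (Within.seq (Within.push (update_st_one ..))
          (Within.seq (Within.pop (update_st_zero ..)) (Within.pop (update_st_zero ..))))
      · exact Within.case_true (st_zero ..) (Within.seq (Within.push (update_st_one ..))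
          (Within.seq (Within.pop (update_st_zero ..)) (Within.pop (update_st_zero ..))))
  refine (Within.seq (key a []) (Within.move (by decide)
    (s' := st [] [] a) (by simp))).mono ?_
  have := length_le_enc a
  simp
  omega

/-! ### Numbers and lists -/

theorem PT.of_str_right {f : α → β} {F : Str → β} (hF : PT F) (h : ∀ a, f a = F (enc a)) :
    PT f := by
  obtain ⟨M, p, hM⟩ := hF
  refine ⟨M, p, fun a => ?_⟩
  rw [h]
  exact hM (enc a)

/-- Whether a number is zero. -/
def isZero (n : ℕ) : Bool := n == 0

@[fun_prop]
theorem PT.isZero' : PT isZero :=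
  .of_str_right .isNil_str fun n => by cases n <;> rfl

@[fun_prop]
theorem PT.succ {f : α → ℕ} (hf : PT f) : PT fun a => f a + 1 :=
  PT.comp (g := fun n => n + 1) (.of_str (.cons_str true) fun _ => rfl) hf

@[fun_prop]
theorem PT.pred' : PT Nat.pred :=
  .of_str .tail_str fun n => by cases n <;> rfl

@[fun_prop]
theorem PT.isEmpty {f : α → List β} (hf : PT f) : PT fun a => (f a).isEmpty :=
  PT.comp (g := List.isEmpty) (.of_str_right .isNil_str fun l => by
    cases l with
    | nil => rfl
    | cons b l => rw [enc_cons]; cases enc b <;> rfl) hf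

@[fun_prop]
theorem PT.cons {f : α → β} {g : α → List β} (hf : PT f) (hg : PT g) : PT fun a => f a :: g a :=
  PT.comp (g := fun p : β × List β => p.1 :: p.2) (.of_str .id fun p => by rw [enc_cons]; rfl)
    (hf.prodMk hg)

/-- The head and the tail of a list, with a default head. -/
def uncons (d : β) : List β → β × List β
  | [] => (d, [])
  | b :: l => (b, l)

/-- A nonempty list and the pair of its head and tail have the same code, so only the empty code has
to be replaced. -/
theorem PT.uncons' (d : β) : PT (uncons d) :=
  .of_str (.orElse_str (enc (d, ([] : List β)))) fun l => by
    cases l with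
    | nil => rfl
    | cons b l =>
      have : (enc (b :: l)).isEmpty = false := by rw [enc_cons]; cases enc b <;> rfl
      have h : ∀ l d : List Bool, l.isEmpty = false → l = bif l.isEmpty then d else l := by
        intro l d h
        rw [h, cond_false]
      exact (enc_cons b l).symm.trans (h _ _ this)

@[fun_prop]
theorem PT.tail {f : α → List β} (hf : PT f) : PT fun a => (f a).tail := by
  refine PT.comp (g := List.tail) ?_ hf
  -- `uncons` needs a default head; if there is none, every list is empty.
  rcases isEmpty_or_nonempty β with h | ⟨⟨d⟩⟩
  · exact (PT.const []).of_eq fun l => by cases l with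
      | nil => rfl
      | cons b l => exact h.elim b
  · exact (PT.snd (PT.uncons' d)).of_eq fun l => by cases l <;> rfl

@[fun_prop]
theorem PT.headD {f : α → List β} (hf : PT f) (d : β) : PT fun a => (f a).headD d :=
  PT.comp (g := fun l => l.headD d)
    ((PT.fst (PT.uncons' d)).of_eq fun l => by cases l <;> rfl) hf

end ShortChoice

namespace ShortChoice

open Turing Function Polynomial
open Enc (enc)

variable {α β γ δ σ : Type} [Enc α] [Enc β] [Enc γ] [Enc δ] [Enc σ]

/-! ### Folds -/

theorem length_enc_drop (l : List α) (i : ℕ) : (enc (l.drop i)).length ≤ (enc l).length := by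
  induction l generalizing i with
  | nil => simp
  | cons a l ih =>
    cases i with
    | zero => simp
    | succ i => simpa using (ih i).trans (by omega)

theorem length_enc_mem {l : List α} {a : α} (h : a ∈ l) : (enc a).length ≤ (enc l).length := by
  induction l with
  | nil => cases h
  | cons b l ih =>
    rcases List.mem_cons.1 h with rfl | h
    · simp; omega
    · have := ih h; simp; omega

/-- One step of a fold. -/
def foldStep (step : γ → σ → α → σ) (p : γ × List α × σ) : γ × List α × σ :=
  match p.2.1 with
  | [] => p
  | a :: l => (p.1, l, step p.1 p.2.2 a)

theorem foldStep_iterate {α γ σ : Type} (step : γ → σ → α → σ) (c : γ) (l : List α) (s : σ) (i : ℕ) :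
    (foldStep step)^[i] (c, l, s) = (c, l.drop i, (l.take i).foldl (step c) s) := by
  induction i generalizing l s with
  | zero => simp
  | succ i ih =>
    rw [iterate_succ_apply]
    cases l with
    | nil => rw [foldStep, ih]; simp
    | cons a l => rw [foldStep, ih]; simp

theorem PT.foldl' {step : γ → σ → α → σ} (hs : PT fun p : γ × σ × α => step p.1 p.2.1 p.2.2)
    (b : ℕ[X]) (hb : ∀ c (l : List α) s i, (enc ((l.take i).foldl (step c) s)).length ≤
      b.eval (enc (c, l, s)).length) :
    PT fun p : γ × List α × σ => p.2.1.foldl (step p.1) p.2.2 := by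
  have hT : PT (foldStep step) := by
    rcases isEmpty_or_nonempty α with h | ⟨⟨d⟩⟩
    · refine PT.id.of_eq fun p => ?_
      obtain ⟨c, l, s⟩ := p
      cases l with
      | nil => rfl
      | cons a l => exact h.elim a
    · have h₁ : PT fun p : γ × List α × σ => bif p.2.1.isEmpty then p else
          (p.1, p.2.1.tail, step p.1 p.2.2 (p.2.1.headD d)) := by
        have h₂ : PT fun p : γ × List α × σ => step p.1 p.2.2 (p.2.1.headD d) :=
          hs.comp (f := fun p : γ × List α × σ => (p.1, p.2.2, p.2.1.headD d)) (by fun_prop)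
        fun_prop
      refine h₁.of_eq fun p => ?_
      obtain ⟨c, l, s⟩ := p
      cases l <;> rfl
  have h := PT.iterate hT (2 * X + 1 + (2 * X + b.comp X + 1)) (by
    intro n x i hi
    obtain ⟨c, l, s⟩ := x
    rw [foldStep_iterate]
    have h₁ := hb c l s i
    have h₂ := length_enc_drop l i
    have h₃ : (enc (c, l, s)).length ≤ (enc (n, c, l, s)).length := by simp; omega
    have h₄ := h₁.trans (eval_mono b h₃)
    have h₅ : 2 * (enc c).length + (2 * (enc l).length + (enc s).length + 1) + 1 ≤
      (enc (n, c, l, s)).length := by simp; omega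
    generalize (enc (n, c, l, s)).length = z at *
    simp
    omega)
  -- `foldStep` is stationary once the list is used up, so any upper bound for the number of entries
  -- will do. The length of the code is one, and it does not presuppose folds.
  have h' : PT fun p : γ × List α × σ => (foldStep step)^[codeLength p.2.1] p :=
    h.comp (f := fun p : γ × List α × σ => (codeLength p.2.1, p)) (by fun_prop)
  refine h'.snd.snd.of_eq fun p => ?_
  obtain ⟨c, l, s⟩ := p
  rw [foldStep_iterate]
  simp [List.take_of_length_le (length_le_enc l), codeLength]

theorem PT.foldl_of_le {l : α → List β} {s : α → σ} {step : α → σ → β → σ} (hl : PT l)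
    (hs : PT s) (hstep : PT fun p : α × σ × β => step p.1 p.2.1 p.2.2) (b : ℕ[X])
    (hb : ∀ a (l : List β) s i, (enc ((l.take i).foldl (step a) s)).length ≤ b.eval (enc (a, l, s)).length) :
    PT fun a => (l a).foldl (step a) (s a) :=
  (PT.foldl' hstep b hb).comp (f := fun a => (a, l a, s a)) (by fun_prop)

/-- The increment allowed by `hq` does not depend on the accumulator, so the total growth is at most
the number of entries times a polynomial. -/
theorem PT.foldl {l : α → List β} {s : α → σ} {step : α → σ → β → σ} (hl : PT l)
    (hs : PT s) (hstep : PT fun p : α × σ × β => step p.1 p.2.1 p.2.2) (q : ℕ[X])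
    (hq : ∀ a s b, (enc (step a s b)).length ≤
      (enc s).length + q.eval ((enc a).length + (enc b).length)) :
    PT fun a => (l a).foldl (step a) (s a) := by
  refine PT.foldl_of_le hl hs hstep (X + X * q) fun a l s i => ?_
  have key : ∀ l' : List β, (enc (l'.foldl (step a) s)).length ≤
      (enc s).length + l'.length * q.eval ((enc a).length + (enc l').length) := by
    intro l'
    induction l' using List.reverseRecOn with
    | nil => simp
    | append_singleton l' b ih =>
      rw [List.foldl_append]
      refine (hq a _ b).trans ((Nat.add_le_add_right ih _).trans ?_)
      have h₁ := eval_mono q (show (enc a).length + (enc l').length ≤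
        (enc a).length + (enc (l' ++ [b])).length by simp)
      have h₂ := eval_mono q (show (enc a).length + (enc b).length ≤
        (enc a).length + (enc (l' ++ [b])).length by simp; omega)
      generalize q.eval ((enc a).length + (enc (l' ++ [b])).length) = Q at *
      have h₃ := Nat.mul_le_mul_left l'.length h₁
      have h₄ : (l' ++ [b]).length * Q = l'.length * Q + Q := by simp; ring
      omega
  have h₁ := key (l.take i)
  have h₂ : (enc (l.take i)).length ≤ (enc l).length := by
    have := length_enc_append (l.take i) (l.drop i)
    rw [List.take_append_drop] at this
    omega
  have h₃ := eval_mono q (show (enc a).length + (enc (l.take i)).length ≤ (enc (a, l, s)).length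
    by simp; omega)
  have h₄ := Nat.mul_le_mul ((length_le_enc (l.take i)).trans (h₂.trans
    (show _ ≤ (enc (a, l, s)).length by simp; omega))) h₃
  have h₅ : (enc s).length ≤ (enc (a, l, s)).length := by simp; omega
  simp only [eval_add, eval_mul, eval_X]
  omega

/-! ### Lists -/

@[fun_prop]
theorem PT.reverse {f : α → List β} (hf : PT f) : PT fun a => (f a).reverse := by
  refine PT.comp (g := List.reverse) ?_ hf
  have h : PT fun l : List β => l.foldl (fun acc b => b :: acc) [] :=
    PT.foldl (step := fun _ acc b => b :: acc) PT.id (PT.const []) (by fun_prop) (2 * X + 1)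
      fun a s b => by simp; omega
  exact h.of_eq fun l => by simp

@[fun_prop]
theorem PT.append {f g : α → List β} (hf : PT f) (hg : PT g) : PT fun a => f a ++ g a := by
  have h : PT fun a => (f a).reverse.foldl (fun acc b => b :: acc) (g a) :=
    PT.foldl (step := fun _ acc b => b :: acc) (by fun_prop) hg (by fun_prop) (2 * X + 1)
      fun a s b => by simp; omega
  exact h.of_eq fun l => by simp

/-- A size bound for a function of two arguments. -/
theorem PT.size₂ {f : α → β → γ} (hf : PT fun p : α × β => f p.1 p.2) :
    ∃ q : ℕ[X], ∀ a b, (enc (f a b)).length ≤ q.eval ((enc a).length + (enc b).length) := by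
  obtain ⟨q, hq⟩ := hf.size
  refine ⟨q.comp (2 * X + 1), fun a b => (hq (a, b)).trans ?_⟩
  rw [eval_comp]
  exact eval_mono q (by simp; omega)

@[fun_prop]
theorem PT.flatMap {l : α → List β} {f : α → β → List γ} (hl : PT l)
    (hf : PT fun p : α × β => f p.1 p.2) : PT fun a => (l a).flatMap (f a) := by
  obtain ⟨q, hq⟩ := hf.size₂
  have h : PT fun a => (l a).foldl (fun acc b => acc ++ f a b) [] := by
    refine PT.foldl (step := fun a acc b => acc ++ f a b) hl (PT.const []) ?_ q
      fun a s b => by simpa using hq a b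
    have : PT fun p : α × List γ × β => f p.1 p.2.2 :=
      hf.comp (f := fun p : α × List γ × β => (p.1, p.2.2)) (by fun_prop)
    fun_prop
  refine h.of_eq fun a => ?_
  rw [← List.nil_append (List.flatMap _ _)]
  generalize [] = acc
  induction l a generalizing acc with
  | nil => simp
  | cons b l ih => simp [ih]

@[fun_prop]
theorem PT.map {l : α → List β} {f : α → β → γ} (hl : PT l)
    (hf : PT fun p : α × β => f p.1 p.2) : PT fun a => (l a).map (f a) := by
  have h : PT fun a => (l a).flatMap fun b => [f a b] :=
    PT.flatMap hl (PT.cons hf (PT.const []))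
  exact h.of_eq fun a => by rw [← List.map_eq_flatMap]

/-! ### Booleans -/

@[fun_prop]
theorem PT.not {f : α → Bool} (hf : PT f) : PT fun a => !(f a) :=
  (PT.cond hf (PT.const false) (PT.const true)).of_eq fun a => by cases f a <;> rfl

@[fun_prop]
theorem PT.and {f g : α → Bool} (hf : PT f) (hg : PT g) : PT fun a => f a && g a :=
  (PT.cond hf hg (PT.const false)).of_eq fun a => by cases f a <;> rfl

@[fun_prop]
theorem PT.beq_bool {f g : α → Bool} (hf : PT f) (hg : PT g) : PT fun a => f a == g a :=
  (PT.cond hf hg hg.not).of_eq fun a => by cases f a <;> cases g a <;> rfl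

@[fun_prop]
theorem PT.ite {c : α → Prop} [∀ a, Decidable (c a)] {f g : α → β} (hc : PT fun a => decide (c a))
    (hf : PT f) (hg : PT g) : PT fun a => if c a then f a else g a :=
  (PT.cond hc hf hg).of_eq fun a => by by_cases h : c a <;> simp [h]

@[fun_prop]
theorem PT.all {l : α → List β} {f : α → β → Bool} (hl : PT l)
    (hf : PT fun p : α × β => f p.1 p.2) : PT fun a => (l a).all (f a) := by
  have h : PT fun a => ((l a).flatMap fun b => bif f a b then [] else [true]).isEmpty :=
    PT.isEmpty (PT.flatMap hl (PT.cond hf (PT.const []) (PT.const [true])))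
  refine h.of_eq fun a => ?_
  induction l a with
  | nil => rfl
  | cons b l ih => cases h : f a b <;> simp [h, ← ih]

/-! ### Numbers -/

/-- A number as a list. -/
def ticks (n : ℕ) : List Bool := List.replicate n true

@[fun_prop]
theorem PT.ticks' : PT ticks :=
  PT.str_toList.comp (f := fun n : ℕ => Str.ofList (enc n)) (.of_str .id fun _ => rfl)

theorem foldl_ticks {σ : Type} (f : σ → σ) (s : σ) (n : ℕ) : (ticks n).foldl (fun s _ => f s) s = f^[n] s := by
  induction n generalizing s with
  | zero => rfl
  | succ n ih => exact ih (f s)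

theorem PT.iterate_add {n : α → ℕ} {s : α → σ} {step : α → σ → σ} (hn : PT n) (hs : PT s)
    (hstep : PT fun p : α × σ => step p.1 p.2) (q : ℕ[X])
    (hq : ∀ a s, (enc (step a s)).length ≤ (enc s).length + q.eval (enc a).length) :
    PT fun a => (step a)^[n a] (s a) := by
  have h : PT fun a => (ticks (n a)).foldl (fun s _ => step a s) (s a) :=
    PT.foldl (step := fun a s _ => step a s) (by fun_prop) hs
      (hstep.comp (f := fun p : α × σ × Bool => (p.1, p.2.1)) (by fun_prop)) q
      fun a s b => (hq a s).trans (Nat.add_le_add_left (eval_mono q (by omega)) _)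
  exact h.of_eq fun a => foldl_ticks _ _ _

@[fun_prop]
theorem PT.add {f g : α → ℕ} (hf : PT f) (hg : PT g) : PT fun a => f a + g a := by
  have h : PT fun a => (fun n => n + 1)^[g a] (f a) :=
    PT.iterate_add (step := fun _ n => n + 1) hg hf (by fun_prop) 1 fun a s => by simp
  exact h.of_eq fun a => by simp

@[fun_prop]
theorem PT.sub {f g : α → ℕ} (hf : PT f) (hg : PT g) : PT fun a => f a - g a := by
  have h : PT fun a => Nat.pred^[g a] (f a) :=
    PT.iterate_add (step := fun _ n => Nat.pred n) hg hf (by fun_prop) 1 fun a s => by simp; omega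
  exact h.of_eq fun a => by rw [Nat.pred_iterate]

@[fun_prop]
theorem PT.mul {f g : α → ℕ} (hf : PT f) (hg : PT g) : PT fun a => f a * g a := by
  obtain ⟨q, hq⟩ := hf.size
  have h : PT fun a => (fun n => n + f a)^[g a] 0 :=
    PT.iterate_add (step := fun a n => n + f a) hg (PT.const 0)
      (PT.add PT.snd' (hf.comp PT.fst')) q fun a s => by simpa using hq a
  refine h.of_eq fun a => ?_
  generalize g a = n
  induction n with
  | zero => rfl
  | succ n ih => rw [iterate_succ_apply', ih]; rfl

@[fun_prop]
theorem PT.decide_lt {f g : α → ℕ} (hf : PT f) (hg : PT g) : PT fun a => decide (f a < g a) :=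
  (PT.not (PT.isZero'.comp (hg.sub hf))).of_eq fun a => by
    by_cases h : f a < g a
    · simp [h, isZero]; omega
    · simp [h, isZero]; omega

@[fun_prop]
theorem PT.decide_eq {f g : α → ℕ} (hf : PT f) (hg : PT g) : PT fun a => decide (f a = g a) :=
  ((hf.decide_lt hg).not.and (hg.decide_lt hf).not).of_eq fun a => by
    by_cases h : f a = g a
    · simp [h]
    · simp [h]; omega

@[fun_prop]
theorem PT.length {f : α → List β} (hf : PT f) : PT fun a => (f a).length := by
  refine PT.comp (g := List.length) ?_ hf
  have h : PT fun l : List β => l.foldl (fun n _ => n + 1) 0 :=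
    PT.foldl (step := fun _ n _ => n + 1) PT.id (PT.const 0) (by fun_prop) 1 fun a s b => by simp
  exact h.of_eq fun l => by simp

@[fun_prop]
theorem PT.range {f : α → ℕ} (hf : PT f) : PT fun a => List.range (f a) := by
  refine PT.comp (g := List.range) ?_ hf
  -- `n - (n - acc.length)` is `min n acc.length`. The cap at `n` makes the increment bounded for
  -- every accumulator, including those that never occur.
  have h : PT fun n : ℕ => (fun acc => acc ++ [n - (n - acc.length)])^[n] ([] : List ℕ) :=
    PT.iterate_add (step := fun n acc => acc ++ [n - (n - List.length acc)]) PT.id (PT.const [])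
      (by fun_prop) (2 * X + 1) fun a s => by simp
  refine h.of_eq fun n => ?_
  have : ∀ k ≤ n, (fun acc => acc ++ [n - (n - acc.length)])^[k] ([] : List ℕ) = List.range k := by
    intro k hk
    induction k with
    | zero => rfl
    | succ k ih =>
      rw [iterate_succ_apply', ih (by omega), List.range_succ, List.length_range,
        Nat.sub_sub_self (by omega)]
  exact this n le_rfl

@[fun_prop]
theorem PT.drop {f : α → List β} {n : α → ℕ} (hn : PT n) (hf : PT f) :
    PT fun a => (f a).drop (n a) := by
  have h : PT fun a => List.tail^[n a] (f a) :=
    PT.iterate_add (step := fun _ l => List.tail l) hn hf (by fun_prop) 0 fun a s => by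
      simpa using length_enc_drop s 1
  refine h.of_eq fun a => ?_
  generalize f a = l
  induction n a generalizing l with
  | zero => rfl
  | succ n ih => rw [iterate_succ_apply, ih]; simp

@[fun_prop]
theorem PT.take {f : α → List β} {n : α → ℕ} (hn : PT n) (hf : PT f) :
    PT fun a => (f a).take (n a) := by
  have h : PT fun a => ((f a).reverse.drop ((f a).length - n a)).reverse := by fun_prop
  refine h.of_eq fun a => ?_
  rw [List.drop_reverse]
  simp
  omega

@[fun_prop]
theorem PT.getD {f : α → List β} {n : α → ℕ} (hf : PT f) (hn : PT n) (d : β) :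
    PT fun a => (f a).getD (n a) d := by
  have h : PT fun a => ((f a).drop (n a)).headD d := by fun_prop
  refine h.of_eq fun a => ?_
  rw [List.headD_eq_head?_getD, List.head?_drop, List.getD_eq_getElem?_getD]

@[fun_prop]
theorem PT.replicate {n : α → ℕ} {f : α → β} (hn : PT n) (hf : PT f) :
    PT fun a => List.replicate (n a) (f a) := by
  have h : PT fun a => (List.range (n a)).map fun _ => f a :=
    PT.map (f := fun a _ => f a) (by fun_prop) (by fun_prop)
  exact h.of_eq fun a => by simp

@[fun_prop]
theorem PT.dropLast {f : α → List β} (hf : PT f) : PT fun a => (f a).dropLast := by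
  have h : PT fun a => (f a).reverse.tail.reverse := by fun_prop
  exact h.of_eq fun a => by simp

end ShortChoice

/-! ### The combinatorial core: labels, rounds and the value recovered from a certificate. -/

namespace ShortChoice

/-! ### Labels -/

/-- The label `0 1 … 1`. -/
def pivot (n : ℕ) : List Bool := false :: List.replicate (n - 1) true

/-- Remove the label `d`: its place is taken by the pivot. -/
def relabel (n : ℕ) (d w : List Bool) : List Bool := if w = pivot n then d else w

/-- The label in the next round: the first bit is dropped. -/
def nextLabel (n : ℕ) (d w : List Bool) : List Bool := (relabel n d w).tail ++ [true]

/-- The first bit of the label, after the removal of `d`. -/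
def labelBit (n : ℕ) (d w : List Bool) : Bool := (relabel n d w).headD false

/-- The label different from `d` with first bit `b` after the removal of `d`, and with next label
`u`. -/
def prevLabel (n : ℕ) (d : List Bool) (b : Bool) (u : List Bool) : List Bool :=
  if b :: u.dropLast = d then pivot n else b :: u.dropLast

/-- The relabelled string must be `b :: u.dropLast`. It equals neither `pivot n` nor the all-ones
string, because `u` ends in a one but is not all ones. So it can be its own preimage under
`relabel`, unless it is the removed label `d`; in that case the preimage is the pivot. Going back
one round uses up one of the trailing ones. -/
theorem prevLabel_spec {n r : ℕ} {d u : List Bool} {b : Bool} (hu : u.length = n)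
    (hs : List.replicate (r + 1) true <:+ u) (hne : u ≠ List.replicate n true) :
    nextLabel n d (prevLabel n d b u) = u ∧ labelBit n d (prevLabel n d b u) = b ∧
      prevLabel n d b u ≠ d ∧ prevLabel n d b u ≠ List.replicate n true ∧
      List.replicate r true <:+ prevLabel n d b u ∧ (prevLabel n d b u).length = n := by
  obtain ⟨s, hs⟩ := hs
  have hn : n = s.length + (r + 1) := by rw [← hu, ← hs]; simp
  have hv : u.dropLast = s ++ List.replicate r true := by
    rw [← hs, List.replicate_succ', ← List.append_assoc, List.dropLast_concat]
  have hv' : u.dropLast ++ [true] = u := by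
    rw [hv, ← hs, List.replicate_succ', List.append_assoc]
  have hd : u.dropLast ≠ List.replicate (n - 1) true := by
    intro h
    apply hne
    rw [← hv', h, ← List.replicate_succ', hn]
    rfl
  have hp : b :: u.dropLast ≠ pivot n := by
    intro h
    exact hd (List.cons.inj h).2
  have hr : List.replicate n true = true :: List.replicate (n - 1) true := by
    rw [hn]; rfl
  have hpr : pivot n ≠ List.replicate n true := by
    rw [hr]; simp [pivot]
  have hbr : b :: u.dropLast ≠ List.replicate n true := by
    rw [hr]; exact fun h => hd (List.cons.inj h).2
  have hps : List.replicate r true <:+ pivot n := by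
    refine ⟨false :: List.replicate s.length true, ?_⟩
    simp [pivot, hn, List.replicate_append_replicate]
  have hpl : (pivot n).length = n := by simp [pivot]; omega
  unfold prevLabel
  by_cases h : b :: u.dropLast = d
  · rw [if_pos h]
    refine ⟨?_, ?_, fun h' => hp (h.trans h'.symm), hpr, hps, hpl⟩
    · rw [nextLabel, relabel, if_pos rfl, ← h]; exact hv'
    · rw [labelBit, relabel, if_pos rfl, ← h]; rfl
  · rw [if_neg h]
    refine ⟨?_, ?_, h, hbr, ⟨b :: s, by rw [hv]; rfl⟩, by simp [hv, hn, add_assoc]⟩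
    · rw [nextLabel, relabel, if_neg hp]; exact hv'
    · rw [labelBit, relabel, if_neg hp]; rfl

/-- The label after the removal of the labels `ds`. -/
def trace (n : ℕ) (ds : List (List Bool)) (w : List Bool) : List Bool :=
  ds.foldl (fun w d => nextLabel n d w) w

/-- The initial label that follows given bits to a given final label. -/
def untrace (n : ℕ) (L : List (List Bool × Bool)) (u : List Bool) : List Bool :=
  L.foldr (fun p u => prevLabel n p.1 p.2 u) u

/-- Iterates `prevLabel_spec`: each trailing one of `u` pays for one round undone, and `r` of them
are left over. The last clause is the essential one: the label escapes every removal and shows the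
prescribed bits. -/
theorem untrace_spec {n : ℕ} {u : List Bool} (hu : u.length = n)
    (hne : u ≠ List.replicate n true) (L : List (List Bool × Bool)) (r : ℕ)
    (hs : List.replicate (r + L.length) true <:+ u) :
    (untrace n L u).length = n ∧ untrace n L u ≠ List.replicate n true ∧
      List.replicate r true <:+ untrace n L u ∧
      trace n (L.map Prod.fst) (untrace n L u) = u ∧
      ∀ j (h : j < L.length), trace n ((L.take j).map Prod.fst) (untrace n L u) ≠ L[j].1 ∧
        labelBit n L[j].1 (trace n ((L.take j).map Prod.fst) (untrace n L u)) = L[j].2 := by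
  induction L generalizing r with
  | nil => exact ⟨hu, hne, hs, rfl, fun j h => by simp at h⟩
  | cons p L ih =>
    obtain ⟨h₁, h₂, h₃, h₄, h₅⟩ := ih (r + 1) (by
      rw [List.length_cons] at hs
      rwa [add_assoc, add_comm 1])
    obtain ⟨k₁, k₂, k₃, k₄, k₅, k₆⟩ := prevLabel_spec (d := p.1) (b := p.2) h₁ h₃ h₂
    have e : untrace n (p :: L) u = prevLabel n p.1 p.2 (untrace n L u) := rfl
    rw [e]
    have e' : ∀ M : List (List Bool × Bool), trace n ((p :: M).map Prod.fst)
        (prevLabel n p.1 p.2 (untrace n L u)) = trace n (M.map Prod.fst) (untrace n L u) := by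
      intro M
      simp only [trace, List.map_cons, List.foldl_cons, k₁]
    refine ⟨k₆, k₄, k₅, by rw [e', h₄], fun j hj => ?_⟩
    cases j with
    | zero => exact ⟨k₃, k₂⟩
    | succ j =>
      rw [List.take_succ_cons, e']
      exact h₅ j (by simpa using hj)

/-- The labels that are removed when the objects `as` are chosen. -/
def pivots (n : ℕ) (C : Circuit) (as : List (List Bool)) : List (List Bool) :=
  as.foldl (fun ds a => ds ++ [trace n ds (C.eval a)]) []

@[simp] theorem pivots_append_singleton (n : ℕ) (C : Circuit) (as : List (List Bool))
    (a : List Bool) : pivots n C (as ++ [a]) =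
      pivots n C as ++ [trace n (pivots n C as) (C.eval a)] := by
  simp [pivots]

@[simp] theorem length_pivots (n : ℕ) (C : Circuit) (as : List (List Bool)) :
    (pivots n C as).length = as.length := by
  induction as using List.reverseRecOn with
  | nil => rfl
  | append_singleton as a ih => simp [ih]

theorem pivots_take (n : ℕ) (C : Circuit) (as : List (List Bool)) (j : ℕ) :
    pivots n C (as.take j) = (pivots n C as).take j := by
  induction as using List.reverseRecOn with
  | nil => simp [pivots]
  | append_singleton as a ih =>
    rcases le_or_gt j as.length with h | h
    · rw [List.take_append_of_le_length h, ih, pivots_append_singleton,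
        List.take_append_of_le_length (by simpa using h)]
    · rw [List.take_of_length_le (by simp; omega), List.take_of_length_le (by simp; omega)]

/-- The label removed in round `j` is the current label of the object chosen there; an object whose
label escapes the removal is therefore a different object. -/
theorem pivots_getElem (n : ℕ) (C : Circuit) (as : List (List Bool)) (j : ℕ)
    (h : j < as.length) : (pivots n C as)[j]'(by simpa using h) =
      trace n ((pivots n C as).take j) (C.eval as[j]) := by
  have h₁ : as.take (j + 1) = as.take j ++ [as[j]] := by
    rw [List.take_append_getElem]
  have h₂ := pivots_take n C as (j + 1)
  rw [h₁, pivots_append_singleton] at h₂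
  have h₃ : (pivots n C as)[j]'(by simpa using h) =
      ((pivots n C as).take (j + 1))[j]'(by simp [h]) := by simp
  rw [h₃]
  simp only [← h₂, pivots_take]
  rw [List.getElem_append_right (by simp)]
  simp

/-- The predicate on `(a 0, …, a i, x)`, for a nonempty list `as = [a 0, …, a i]`. -/
def choiceBit (n : ℕ) (C : Circuit) (as : List (List Bool)) (x : List Bool) : Bool :=
  labelBit n (trace n (pivots n C as.dropLast) (C.eval (as.getLastD [])))
    (trace n (pivots n C as.dropLast) (C.eval x))

theorem choiceBit_take (n : ℕ) (C : Circuit) (as : List (List Bool)) (x : List Bool) (i : ℕ)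
    (h : i < as.length) : choiceBit n C (as.take (i + 1)) x =
      labelBit n ((pivots n C as)[i]'(by simpa using h))
        (trace n ((pivots n C as).take i) (C.eval x)) := by
  have h₁ : as.take (i + 1) = as.take i ++ [as[i]] := by
    rw [List.take_append_getElem]
  have h₂ : (as.take i ++ [as[i]]).getLastD [] = as[i] := by
    rw [List.getLastD_eq_getLast?, List.getLast?_concat]
    rfl
  rw [choiceBit, h₁, List.dropLast_concat, pivots_take, pivots_getElem n C as i h, h₂]

/-! ### The solution of Empty obtained from a certificate -/

/-- The bits chosen by the certificate `as`, `c`. -/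
def choiceBits (n : ℕ) (C : Circuit) (as : List (List Bool)) (c : Bool) : List Bool :=
  ((List.range (as.length - 1)).map fun j => choiceBit n C (as.take (j + 1)) (as.getLastD [])) ++ [c]

/-- The final label, after `k` rounds. -/
def target (n k : ℕ) : List Bool := List.replicate (n - k) false ++ List.replicate k true

/-- The value that is not taken, obtained from the certificate `as`, `c`. -/
def solution (n : ℕ) (C : Circuit) (as : List (List Bool)) (c : Bool) : List Bool :=
  untrace n ((pivots n C as).zip (choiceBits n C as c)) (target n as.length)

/-- `P` is a sequence of circuits for the predicates `choiceBit`. -/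
def Represents (n : ℕ) (C : Circuit) (P : List Circuit) : Prop :=
  ∀ (as : List (List Bool)) (x : List Bool), as ≠ [] → as.length ≤ n - 1 →
    (∀ a ∈ as, a.length = n) → x.length = n →
      predVal P (as.length - 1) (as ++ [x]) = [choiceBit n C as x]

theorem val_lt {x : List Bool} (hx : x ≠ List.replicate x.length true) :
    val x < 2 ^ x.length - 1 := by
  induction x with
  | nil => exact (hx rfl).elim
  | cons b x ih =>
    have e : val (b :: x) = b.toNat + 2 * val x := by simp [val, Nat.ofDigits_cons]
    have h₁ : val x < 2 ^ x.length := by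
      have := Nat.ofDigits_lt_base_pow_length (b := 2) (l := x.map Bool.toNat) (by norm_num)
        (by simp; intro y; cases y <;> simp)
      simpa [val] using this
    rw [e, List.length_cons, pow_succ]
    cases b
    · simp; omega
    · have := ih (by rintro h; apply hx; rw [h]; simp [List.replicate_succ])
      simp; omega

/-- An object with the reconstructed label would extend the certificate with final bit `c`, which
its maximality forbids. -/
theorem solution_correct {n : ℕ} {C : Circuit} {P : List Circuit} (hP : Represents n C P)
    {as : List (List Bool)} {c : Bool} (h : IsCertificate n P as c) :
    solution n C as c ∈ bounded n (2 ^ n - 1) ∧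
      ∀ a ∈ bounded n (2 ^ n - 2), C.eval a ≠ solution n C as c := by
  obtain ⟨⟨hne, hU, hnd, hsub⟩, hlen, hmax⟩ := h
  have hpos : 0 < as.length := List.length_pos_iff.2 hne
  set L := (pivots n C as).zip (choiceBits n C as c) with hL
  have hLlen : L.length = as.length := by simp [hL, choiceBits]; omega
  have hfst : L.map Prod.fst = pivots n C as := by
    rw [hL, List.map_fst_zip]
    simp [choiceBits]; omega
  -- Since `as.length ≤ n - 1` and `as` is nonempty, the target still begins with `false` and so is
  -- not all ones. Its `as.length` trailing ones allow exactly the required number of rounds to be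
  -- undone, whence `r = 0`.
  obtain ⟨h₁, h₂, -, -, h₅⟩ := untrace_spec (n := n) (u := target n as.length)
    (by simp [target]; omega)
    (by
      intro h
      have : (target n as.length).head? = (List.replicate n true).head? := by rw [h]
      simp [target, List.head?_replicate] at this
      rw [if_neg (by omega), if_neg (by omega)] at this
      simp at this) L 0 (by
      rw [hLlen, zero_add]
      exact ⟨_, rfl⟩)
  change (solution n C as c).length = n at h₁
  refine ⟨⟨h₁, ?_⟩, ?_⟩
  · have := val_lt (x := solution n C as c) (by rw [h₁]; exact h₂)
    rwa [h₁] at this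
  intro x hx hCx
  have hxn : x.length = n := hx.1
  have key : ∀ j (hj : j < as.length),
      trace n ((pivots n C as).take j) (C.eval x) ≠ (pivots n C as)[j]'(by simpa using hj) ∧
      choiceBit n C (as.take (j + 1)) x =
        (choiceBits n C as c)[j]'(by simp [choiceBits]; omega) := by
    intro j hj
    have := h₅ j (by omega)
    rw [List.map_take, hfst] at this
    rw [choiceBit_take n C as x j hj, hCx]
    simpa [hL, solution] using this
  have hxas : x ∉ as := by
    intro hmem
    obtain ⟨j, hj, rfl⟩ := List.getElem_of_mem hmem
    exact (key j hj).1 (pivots_getElem n C as j hj).symm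
  have hPr : ∀ i < as.length, ∀ b : List Bool, b.length = n →
      predVal P i (as.take (i + 1) ++ [b]) = [choiceBit n C (as.take (i + 1)) b] := by
    intro i hi b hb
    have := hP (as.take (i + 1)) b (by simp [hne]) (by simp; omega)
      (fun a ha => (hU a (List.mem_of_mem_take ha)).1) hb
    rwa [List.length_take, min_eq_left (by omega), Nat.add_sub_cancel] at this
  have hlast : as.getLastD [] = as[as.length - 1] := by
    rw [List.getLastD_eq_getLast?, List.getLast?_eq_getElem?, List.getElem?_eq_getElem (by omega)]
    rfl
  refine hmax ⟨x, hx, ⟨by simp, ?_, ?_, ?_⟩, ?_⟩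
  · intro a ha
    rcases List.mem_append.1 ha with ha | ha
    · exact hU a ha
    · rw [List.mem_singleton.1 ha]; exact hx
  · rw [List.nodup_append]
    refine ⟨hnd, by simp, ?_⟩
    rintro a ha b hb rfl
    rw [List.mem_singleton.1 hb] at ha
    exact hxas ha
  · intro i hi
    -- An old object `b` after position `i` has the same bit as the last object of `as`, which is
    -- the prescribed bit; the new object `x` has the prescribed bit by `key`. For `i = as.length -
    -- 1` only `x` comes later.
    have main : ∀ j b, i < j → (as ++ [x])[j]? = some b →
        predVal P i ((as ++ [x]).take (i + 1) ++ [b]) =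
          [(choiceBits n C as c).getD i false] := by
      intro j b hij hb
      have hj : j < as.length + 1 := by
        by_contra hj
        rw [List.getElem?_eq_none (by simp; omega)] at hb
        cases hb
      have hi' : i < as.length := by omega
      rw [List.take_append_of_le_length (by omega)]
      rcases Nat.lt_or_ge j as.length with hj' | hj'
      · rw [List.getElem?_append_left hj'] at hb
        have hb' : as[as.length - 1]? = some as[as.length - 1] :=
          List.getElem?_eq_getElem (by omega)
        rw [hsub i hi j (as.length - 1) b _ hij (by omega) hb hb',
          hPr i hi' _ (hU _ (List.getElem_mem _)).1, ← hlast]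
        have : i < as.length - 1 := by omega
        rw [choiceBits, List.getD_eq_getElem?_getD, List.getElem?_append_left (by simpa using this)]
        simp [this]
      · obtain rfl : j = as.length := by omega
        rw [List.getElem?_append_right le_rfl] at hb
        obtain rfl : x = b := by simpa using hb
        rw [hPr i hi' x hxn, (key i hi').2, List.getD_eq_getElem?_getD,
          List.getElem?_eq_getElem (by simp [choiceBits]; omega)]
        rfl
    intro j j' b b' hj hj' hb hb'
    rw [main j b hj hb, main j' b' hj' hb']
  · have h₃ := hPr (as.length - 1) (by omega) x hxn
    have h₄ := (key (as.length - 1) (by omega)).2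
    have e : as.take (as.length - 1 + 1) = as := by rw [Nat.sub_add_cancel hpos, List.take_length]
    rw [e] at h₃ h₄
    rw [h₃, h₄]
    simp [choiceBits]

end ShortChoice

/-! ### Circuits that compute the predicates. -/

namespace ShortChoice

/-! ### Wires and gate equations -/

/-- Every gate of the list satisfies `Q`, the first one being at position `b`. -/
def AllGates (Q : ℕ → Gate → Prop) (b : ℕ) (gs : List Gate) : Prop :=
  ∀ k g, gs[k]? = some g → Q (b + k) g

theorem allGates_append {Q : ℕ → Gate → Prop} {b : ℕ} {gs hs : List Gate} :
    AllGates Q b (gs ++ hs) ↔ AllGates Q b gs ∧ AllGates Q (b + gs.length) hs := by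
  refine ⟨fun h => ⟨fun k g hk => h k g ?_, fun k g hk => ?_⟩, fun h k g hk => ?_⟩
  · rw [List.getElem?_append_left]
    · exact hk
    · by_contra hlt
      rw [List.getElem?_eq_none (by omega)] at hk
      cases hk
  · rw [add_assoc]
    refine h _ g ?_
    rw [List.getElem?_append_right (by omega), Nat.add_sub_cancel_left]
    exact hk
  · rcases Nat.lt_or_ge k gs.length with hlt | hge
    · rw [List.getElem?_append_left hlt] at hk
      exact h.1 k g hk
    · rw [List.getElem?_append_right hge] at hk
      have := h.2 _ g hk
      rwa [show b + gs.length + (k - gs.length) = b + k by omega] at this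

theorem allGates_nil {Q : ℕ → Gate → Prop} {b : ℕ} : AllGates Q b [] := fun k g h => by simp at h

theorem allGates_cons {Q : ℕ → Gate → Prop} {b : ℕ} {g : Gate} {gs : List Gate} :
    AllGates Q b (g :: gs) ↔ Q b g ∧ AllGates Q (b + 1) gs := by
  rw [← List.singleton_append, allGates_append]
  refine and_congr ⟨fun h => h 0 g rfl, fun h k g' hk => ?_⟩ Iff.rfl
  cases k with
  | zero => obtain rfl : g = g' := by simpa using hk
            exact h
  | succ k => simp at hk

theorem allGates_map_range {Q : ℕ → Gate → Prop} {b n : ℕ} {f : ℕ → Gate} :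
    AllGates Q b ((List.range n).map f) ↔ ∀ t < n, Q (b + t) (f t) := by
  refine ⟨fun h t ht => h t _ (by simp [ht]), fun h k g hk => ?_⟩
  rcases Nat.lt_or_ge k n with hlt | hge
  · obtain rfl : f k = g := by simpa [hlt] using hk
    exact h k hlt
  · rw [List.getElem?_eq_none (by simpa using hge)] at hk
    cases hk

theorem length_flatMap_range {s : ℕ} {f : ℕ → List Gate} (n : ℕ)
    (hf : ∀ l < n, (f l).length = s) : ((List.range n).flatMap f).length = n * s := by
  induction n with
  | zero => simp
  | succ n ih =>
    rw [List.range_succ, List.flatMap_append, List.length_append,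
      ih fun l hl => hf l (by omega), List.flatMap_singleton, hf n (by omega), Nat.succ_mul]

theorem allGates_flatMap_range {Q : ℕ → Gate → Prop} {b s n : ℕ} {f : ℕ → List Gate}
    (hf : ∀ l < n, (f l).length = s) :
    AllGates Q b ((List.range n).flatMap f) ↔ ∀ l < n, AllGates Q (b + l * s) (f l) := by
  induction n with
  | zero => simp [allGates_nil]
  | succ n ih =>
    rw [List.range_succ, List.flatMap_append, allGates_append, ih fun l hl => hf l (by omega),
      length_flatMap_range n fun l hl => hf l (by omega), List.flatMap_singleton]
    refine ⟨fun h l hl => ?_, fun h => ⟨fun l hl => h l (by omega), h n (by omega)⟩⟩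
    rcases Nat.lt_succ_iff_lt_or_eq.1 hl with hl | rfl
    · exact h.1 l hl
    · exact h.2

/-- The gate at position `p` reads earlier wires only. -/
def ReadsBelow (p : ℕ) (g : Gate) : Prop := g.fst < p ∧ g.snd < p

/-- The values `W` of the wires satisfy the equation of the gate at position `p`. -/
def Satisfies (W : ℕ → Bool) (p : ℕ) (g : Gate) : Prop := W p = g.fn (W g.fst) (W g.snd)

theorem wires_concat (gs : List Gate) (g : Gate) (x : List Bool) : wires (gs ++ [g]) x =
    wires gs x ++ [g.fn ((wires gs x).getD g.fst false) ((wires gs x).getD g.snd false)] := by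
  simp [wires]

@[simp] theorem length_wires (gs : List Gate) (x : List Bool) :
    (wires gs x).length = x.length + gs.length := by
  induction gs using List.reverseRecOn with
  | nil => rfl
  | append_singleton gs g ih => rw [wires_concat]; simp [ih]; omega

/-- The gate equations of an acyclic circuit determine all wires from the inputs. This uniqueness
identifies the wires of a copy of `C` inside the large circuit with those of `C` itself. -/
theorem wires_eq_of_satisfies {gs : List Gate} {x : List Bool} {V : ℕ → Bool}
    (hgs : AllGates ReadsBelow x.length gs) (hx : ∀ k < x.length, V k = x.getD k false)
    (hV : AllGates (Satisfies V) x.length gs) :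
    ∀ k < x.length + gs.length, (wires gs x).getD k false = V k := by
  induction gs using List.reverseRecOn with
  | nil => exact fun k hk => (hx k hk).symm
  | append_singleton gs g ih =>
    rw [allGates_append, allGates_cons] at hgs hV
    have ih := ih hgs.1 hV.1
    intro k hk
    rw [wires_concat]
    rcases Nat.lt_or_ge k (x.length + gs.length) with h | h
    · rw [← ih k h, List.getD_append _ _ _ _ (by simpa using h)]
    · obtain rfl : k = x.length + gs.length := by simp at hk; omega
      rw [hV.2.1, List.getD_append_right _ _ _ _ (by simp), ih _ hgs.2.1.1, ih _ hgs.2.1.2]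
      simp

theorem satisfies_wires {gs : List Gate} {x : List Bool}
    (hgs : AllGates ReadsBelow x.length gs) :
    (∀ k < x.length, (wires gs x).getD k false = x.getD k false) ∧
      AllGates (Satisfies fun k => (wires gs x).getD k false) x.length gs := by
  induction gs using List.reverseRecOn with
  | nil => exact ⟨fun k _ => rfl, allGates_nil⟩
  | append_singleton gs g ih =>
    rw [allGates_append, allGates_cons] at hgs
    obtain ⟨ih₁, ih₂⟩ := ih hgs.1
    have e : ∀ k < x.length + gs.length, (wires (gs ++ [g]) x).getD k false =
        (wires gs x).getD k false := by
      intro k hk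
      rw [wires_concat, List.getD_append _ _ _ _ (by simpa using hk)]
    refine ⟨fun k hk => (e k (by omega)).trans (ih₁ k hk), allGates_append.2 ⟨?_, ?_⟩⟩
    · intro k g' hk
      have hk' : k < gs.length := by
        by_contra hlt
        rw [List.getElem?_eq_none (by omega)] at hk
        cases hk
      have h₁ := hgs.1 k g' hk
      have h₂ := ih₂ k g' hk
      unfold Satisfies at h₂ ⊢
      beta_reduce at h₂ ⊢
      rw [e _ (by omega), e _ (by have := h₁.1; omega), e _ (by have := h₁.2; omega)]
      exact h₂
    · refine allGates_cons.2 ⟨?_, allGates_nil⟩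
      unfold Satisfies
      beta_reduce
      rw [e _ hgs.2.1.1, e _ hgs.2.1.2, wires_concat,
        List.getD_append_right _ _ _ _ (by simp)]
      simp

/-! ### The circuits of the reduction -/

/-- The wire of the `l`-th copy of a circuit with `n` inputs and `s` gates, `m` being the number
of all inputs. -/
def copyWire (n m s l a : ℕ) : ℕ := if a < n then l * n + a else m + l * s + (a - n)

/-- A copy of a gate. -/
def copyGate (n m s l : ℕ) (g : Gate) : Gate :=
  ⟨g.t00, g.t01, g.t10, g.t11, copyWire n m s l g.fst, copyWire n m s l g.snd⟩

/-- The first wire of the cell for the object `l` in round `j`; `R` is the number of objects. -/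
def cellBase (n R B j l : ℕ) : ℕ := B + (j * R + l) * (3 * n)

/-- The first of the wires with the label of the object `l` in round `j`. -/
def rowBase (n R B j l : ℕ) : ℕ := cellBase n R B j l + 2 * n

/-- The gates of the first round, which copy the label. -/
def startCell (n m s l : ℕ) (outputs : List ℕ) : List Gate :=
  -- The `2 * n` idle gates give the first round the same cell size, with the label again in the
  -- last `n` wires.
  ((List.range (2 * n)).map fun _ => ⟨true, true, true, true, 0, 0⟩) ++ (List.range n).map fun t =>
    ⟨false, false, true, true, copyWire n m s l (outputs.getD t 0),
      copyWire n m s l (outputs.getD t 0)⟩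

/-- The gates at position `c` that compute the next label from the label at `w` and the removed
label at `d`; the wire `one` is constant. -/
def nextCell (n one c d w : ℕ) : List Gate :=
  -- Wire `c + t` says that the bits `0, …, t` of the label agree with `01…1`; thus wire `c + n - 1`
  -- is the test for the pivot.
  ((List.range n).map fun t => if t = 0 then ⟨false, false, true, false, one, w⟩
      else ⟨false, false, false, true, c + t - 1, w + t⟩) ++
    -- All bits of the pivot after the first are ones, so a relabelled bit in these positions is
    -- `(test → d) ∧ w`. The implication and the conjunction occupy one block each; the constant
    -- wire supplies the appended one.
    (((List.range n).map fun t =>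
      ⟨true, true, false, true, c + n - 1, if t + 1 < n then d + t + 1 else one⟩) ++
    ((List.range n).map fun t =>
      ⟨false, false, false, true, c + n + t, if t + 1 < n then w + t + 1 else one⟩))

/-- The gates of the cell for the object `l` in round `j`. -/
def cell (n m s R B : ℕ) (outputs : List ℕ) (j l : ℕ) : List Gate :=
  if j = 0 then startCell n m s l outputs
  else nextCell n (m + R * s) (cellBase n R B j l) (rowBase n R B (j - 1) (j - 1))
    (rowBase n R B (j - 1) l)

/-- The gates of the circuit for the `i`-th predicate, where `R = i + 2`, `m = R * n`. -/
def choiceGates (n m s R B : ℕ) (C : Circuit) : List Gate :=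
  ((List.range R).flatMap fun l => C.gates.map (copyGate n m s l)) ++
    (⟨true, true, true, true, 0, 0⟩ ::
      (((List.range R).flatMap fun j => (List.range R).flatMap fun l =>
        cell n m s R B C.outputs j l) ++
      -- The output is the first bit after relabelling in round `R - 2`. The pivot begins with zero,
      -- so this bit is `(test ∧ d) ∨ w`; the test for the last object is found in its cell of the
      -- following round.
      [⟨false, false, false, true, cellBase n R B (R - 1) (R - 1) + n - 1,
          rowBase n R B (R - 2) (R - 2)⟩,
        ⟨false, true, true, true, rowBase n R B (R - 2) (R - 1), cellBase n R B R 0⟩]))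

/-- The circuit for the `i`-th predicate. -/
def choiceCircuit (n : ℕ) (C : Circuit) (i : ℕ) : Circuit :=
  ⟨choiceGates n ((i + 2) * n) C.gates.length (i + 2)
      ((i + 2) * n + (i + 2) * C.gates.length + 1) C,
    [cellBase n (i + 2) ((i + 2) * n + (i + 2) * C.gates.length + 1) (i + 2) 0 + 1]⟩

theorem cellBase_le {n R B j l j' l' : ℕ} (hj : j' < j) (hl : l' < R) :
    cellBase n R B j' l' + 3 * n ≤ cellBase n R B j l := by
  have h₁ : j' * R + l' + 1 ≤ j * R + l := by
    have : (j' + 1) * R ≤ j * R := Nat.mul_le_mul_right R hj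
    rw [Nat.succ_mul] at this
    omega
  have h₂ := Nat.mul_le_mul_right (3 * n) h₁
  rw [Nat.succ_mul] at h₂
  unfold cellBase
  omega

theorem length_cell (n m s R B : ℕ) (outputs : List ℕ) (j l : ℕ) :
    (cell n m s R B outputs j l).length = 3 * n := by
  unfold cell
  split_ifs
  · simp [startCell]; omega
  · simp [nextCell]; omega

/-- Splits the circuit into its blocks once and for all; it serves for `ReadsBelow` as well as for
`Satisfies`. -/
theorem allGates_choiceGates {Q : ℕ → Gate → Prop} {n m s R B : ℕ} {C : Circuit}
    (hs : s = C.gates.length) (hB : m + R * s + 1 = B) :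
    AllGates Q m (choiceGates n m s R B C) ↔
      (∀ l < R, AllGates (fun p g => Q p (copyGate n m s l g)) (m + l * s) C.gates) ∧
      Q (m + R * s) ⟨true, true, true, true, 0, 0⟩ ∧
      (∀ j < R, ∀ l < R, AllGates Q (cellBase n R B j l) (cell n m s R B C.outputs j l)) ∧
      Q (cellBase n R B R 0) ⟨false, false, false, true, cellBase n R B (R - 1) (R - 1) + n - 1,
          rowBase n R B (R - 2) (R - 2)⟩ ∧
      Q (cellBase n R B R 0 + 1)
        ⟨false, true, true, true, rowBase n R B (R - 2) (R - 1), cellBase n R B R 0⟩ := by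
  have h₁ : ∀ l < R, (C.gates.map (copyGate n m s l)).length = s := fun l _ => by simp [hs]
  have h₂ : ∀ j < R, ∀ l < R, (cell n m s R B C.outputs j l).length = 3 * n :=
    fun j _ l _ => length_cell ..
  have h₃ : ∀ j < R, ((List.range R).flatMap fun l => cell n m s R B C.outputs j l).length =
      R * (3 * n) := fun j hj => length_flatMap_range R (h₂ j hj)
  have h₄ : B + R * (R * (3 * n)) = cellBase n R B R 0 := by
    unfold cellBase; ring
  unfold choiceGates
  rw [allGates_append, allGates_flatMap_range h₁, length_flatMap_range R h₁, allGates_cons,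
    allGates_append, allGates_flatMap_range h₃, length_flatMap_range R h₃, allGates_cons,
    allGates_cons]
  rw [hB, h₄]
  refine and_congr (forall₂_congr fun l _ => ?_) (and_congr Iff.rfl (and_congr
    (forall₂_congr fun j hj => ?_) (and_congr Iff.rfl (and_iff_left allGates_nil))))
  · refine ⟨fun h k g hk => h k _ (by simp [hk]), fun h k g hk => ?_⟩
    rw [List.getElem?_map, Option.map_eq_some_iff] at hk
    obtain ⟨g', hk, rfl⟩ := hk
    exact h k g' hk
  · rw [allGates_flatMap_range (h₂ j hj)]
    refine forall₂_congr fun l _ => ?_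
    rw [show B + j * (R * (3 * n)) + l * (3 * n) = cellBase n R B j l by unfold cellBase; ring]

end ShortChoice

namespace ShortChoice

/-! ### Well-formedness of the circuits -/

theorem copyWire_lt {n s R l a : ℕ} (hl : l < R) (ha : a < n + s) :
    copyWire n (R * n) s l a < R * n + R * s := by
  have h₁ := Nat.mul_le_mul_right n (Nat.succ_le_of_lt hl)
  have h₂ := Nat.mul_le_mul_right s (Nat.succ_le_of_lt hl)
  rw [Nat.succ_mul] at h₁ h₂
  unfold copyWire
  split_ifs <;> omega

theorem copyWire_lt_of_gate {n s R l a k : ℕ} (hl : l < R) (ha : a < n + k) :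
    copyWire n (R * n) s l a < R * n + l * s + k := by
  have h₁ := Nat.mul_le_mul_right n (Nat.succ_le_of_lt hl)
  rw [Nat.succ_mul] at h₁
  unfold copyWire
  split_ifs <;> omega

theorem le_cellBase (n R B j l : ℕ) : B ≤ cellBase n R B j l := Nat.le_add_right _ _

theorem choiceGates_readsBelow {n s R : ℕ} {C : Circuit} (hn : 2 ≤ n) (hR : 2 ≤ R)
    (hs : s = C.gates.length) (hC : C.IsCircuit n n) :
    AllGates ReadsBelow (R * n)
      (choiceGates n (R * n) s R (R * n + R * s + 1) C) := by
  obtain ⟨hC₁, hC₂, hC₃⟩ := hC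
  generalize hB : R * n + R * s + 1 = B
  rw [allGates_choiceGates hs hB]
  have hm : 0 < R * n := Nat.mul_pos (by omega) (by omega)
  refine ⟨fun l hl k g hk => ?_, ⟨by dsimp; omega, by dsimp; omega⟩, fun j hj l hl => ?_, ?_, ?_⟩
  · obtain ⟨h₁, h₂⟩ := hC₁ k g hk
    exact ⟨copyWire_lt_of_gate hl h₁, copyWire_lt_of_gate hl h₂⟩
  · have hc := le_cellBase n R B j l
    unfold cell
    split_ifs with h0
    · rw [startCell, allGates_append, allGates_map_range, allGates_map_range]
      refine ⟨fun t ht => ⟨by dsimp; omega, by dsimp; omega⟩, fun t ht => ?_⟩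
      have h₁ : C.outputs.getD t 0 < n + s := by
        rw [List.getD_eq_getElem _ _ (by omega), hs]
        exact hC₂ _ (List.getElem_mem _)
      have h₂ := copyWire_lt hl h₁
      constructor <;> (dsimp; omega)
    · have h₁ := cellBase_le (n := n) (B := B) (l := l) (show j - 1 < j by omega)
        (show j - 1 < R by omega)
      have h₂ := cellBase_le (n := n) (B := B) (l := l) (show j - 1 < j by omega) hl
      unfold rowBase nextCell
      generalize cellBase n R B j l = c at *
      generalize cellBase n R B (j - 1) l = c₁ at *
      generalize cellBase n R B (j - 1) (j - 1) = c₂ at *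
      rw [allGates_append, allGates_append, allGates_map_range, allGates_map_range,
        allGates_map_range]
      simp only [List.length_map, List.length_range]
      refine ⟨fun t ht => ?_, fun t ht => ?_, fun t ht => ?_⟩
      · split_ifs <;> constructor <;> (dsimp; omega)
      · constructor
        · dsimp; omega
        · dsimp; split_ifs <;> omega
      · constructor
        · dsimp; omega
        · dsimp; split_ifs <;> omega
  · have h₁ := cellBase_le (n := n) (B := B) (l := 0) (show R - 1 < R by omega)
      (show R - 1 < R by omega)
    have h₂ := cellBase_le (n := n) (B := B) (l := 0) (show R - 2 < R by omega)
      (show R - 2 < R by omega)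
    constructor
    · dsimp; omega
    · dsimp [rowBase]; omega
  · have h₁ := cellBase_le (n := n) (B := B) (l := 0) (show R - 2 < R by omega)
      (show R - 1 < R by omega)
    constructor
    · dsimp [rowBase]; omega
    · dsimp; omega

theorem length_choiceGates {n s R : ℕ} {C : Circuit} (hs : s = C.gates.length) :
    R * n + (choiceGates n (R * n) s R (R * n + R * s + 1) C).length =
      cellBase n R (R * n + R * s + 1) R 0 + 2 := by
  have h₁ : ∀ l < R, (C.gates.map (copyGate n (R * n) s l)).length = s := fun l _ => by simp [hs]
  have h₂ : ∀ j < R, ((List.range R).flatMap fun l =>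
      cell n (R * n) s R (R * n + R * s + 1) C.outputs j l).length = R * (3 * n) :=
    fun j hj => length_flatMap_range R fun l _ => length_cell ..
  unfold choiceGates
  rw [List.length_append, List.length_cons, List.length_append, length_flatMap_range R h₁,
    length_flatMap_range R h₂]
  simp only [List.length_cons, List.length_nil, cellBase]
  ring

theorem choiceCircuit_isCircuit {n : ℕ} {C : Circuit} (hn : 2 ≤ n) (hC : C.IsCircuit n n) (i : ℕ) :
    (choiceCircuit n C i).IsCircuit ((i + 2) * n) 1 := by
  refine ⟨choiceGates_readsBelow hn (by omega) rfl hC, ?_, rfl⟩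
  intro w hw
  obtain rfl := List.mem_singleton.1 hw
  have := length_choiceGates (n := n) (R := i + 2) (C := C) rfl
  unfold choiceCircuit
  dsimp only
  omega

/-! ### Correctness of the circuits -/

/-- The bits on `n` consecutive wires. -/
def row (n : ℕ) (W : ℕ → Bool) (b : ℕ) : List Bool := (List.range n).map fun t => W (b + t)

theorem row_eq_pivot {n : ℕ} (hn : 1 ≤ n) {W : ℕ → Bool} {b : ℕ} :
    row n W b = pivot n ↔ W b = false ∧ ∀ t, 0 < t → t < n → W (b + t) = true := by
  obtain ⟨n, rfl⟩ := Nat.exists_eq_add_of_le' hn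
  rw [row, pivot, List.range_succ_eq_map, List.map_cons, List.cons.injEq, Nat.add_sub_cancel,
    List.eq_replicate_iff]
  simp only [List.length_map, List.length_range, true_and, List.map_map, List.mem_map,
    List.mem_range, forall_exists_index, and_imp, Function.comp_apply, Nat.add_zero]
  refine and_congr Iff.rfl ⟨fun h t h0 ht => h _ (t - 1) (by omega) ?_, fun h b t ht hb => ?_⟩
  · rw [show (t - 1).succ = t by omega]
  · rw [← hb]
    exact h _ (by omega) (by omega)

theorem getD_row {n t b : ℕ} {W : ℕ → Bool} (ht : t < n) : (row n W b).getD t false = W (b + t) := by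
  simp [row, ht]

theorem nextCell_correct {n one c d w : ℕ} (hn : 1 ≤ n) {W : ℕ → Bool} (hone : W one = true)
    (h : AllGates (Satisfies W) c (nextCell n one c d w)) :
    W (c + n - 1) = decide (row n W w = pivot n) ∧
      row n W (c + 2 * n) = nextLabel n (row n W d) (row n W w) := by
  rw [nextCell, allGates_append, allGates_append, allGates_map_range, allGates_map_range,
    allGates_map_range] at h
  simp only [List.length_map, List.length_range] at h
  obtain ⟨h₁, h₂, h₃⟩ := h
  have key : ∀ t < n, (W (c + t) = true ↔
      W w = false ∧ ∀ t', 0 < t' → t' ≤ t → W (w + t') = true) := by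
    intro t
    induction t with
    | zero =>
      intro ht
      have := h₁ 0 ht
      rw [if_pos rfl] at this
      rw [this]
      simp only [hone, Gate.fn]
      cases W w <;> simp
      intro t' h h'
      omega
    | succ t ih =>
      intro ht
      have := h₁ (t + 1) ht
      rw [if_neg (by omega)] at this
      unfold Satisfies at this
      dsimp only at this
      have ih := ih (by omega)
      rw [show c + (t + 1) - 1 = c + t by omega] at this
      have e : W (c + (t + 1)) = (W (c + t) && W (w + (t + 1))) := by
        rw [this]
        cases W (c + t) <;> cases W (w + (t + 1)) <;> rfl
      rw [e, Bool.and_eq_true, ih]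
      constructor
      · rintro ⟨⟨k₁, k₂⟩, k₃⟩
        refine ⟨k₁, fun t' h₀ h₁ => ?_⟩
        rcases Nat.lt_or_ge t' (t + 1) with h | h
        · exact k₂ t' h₀ (by omega)
        · obtain rfl : t' = t + 1 := by omega
          exact k₃
      · rintro ⟨k₁, k₂⟩
        exact ⟨⟨k₁, fun t' h₀ h₁ => k₂ t' h₀ (by omega)⟩, k₂ _ (by omega) le_rfl⟩
  have he : W (c + n - 1) = decide (row n W w = pivot n) := by
    rw [Bool.eq_iff_iff, decide_eq_true_iff, row_eq_pivot hn,
      show c + n - 1 = c + (n - 1) by omega, key (n - 1) (by omega)]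
    exact and_congr Iff.rfl (forall₂_congr fun t _ => ⟨fun h ht => h (by omega),
      fun h ht => h (by omega)⟩)
  refine ⟨he, ?_⟩
  have hlen : (relabel n (row n W d) (row n W w)).length = n := by
    unfold relabel
    split_ifs <;> simp [row]
  have hrel : ∀ k < n, (relabel n (row n W d) (row n W w)).getD k false =
      if row n W w = pivot n then W (d + k) else W (w + k) := by
    intro k hk
    unfold relabel
    split_ifs <;> rw [getD_row hk]
  have hN : (nextLabel n (row n W d) (row n W w)).length = n := by
    rw [nextLabel, List.length_append, List.length_tail, hlen, List.length_singleton]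
    omega
  refine List.ext_getElem (by rw [hN]; simp [row]) fun t ht ht' => ?_
  rw [← List.getD_eq_getElem _ false, ← List.getD_eq_getElem _ false]
  rw [hN] at ht'
  have k₂ := h₂ t ht'
  have k₃ := h₃ t ht'
  unfold Satisfies at k₂ k₃
  dsimp only at k₂ k₃
  rw [he] at k₂
  rw [getD_row ht', show c + 2 * n + t = c + n + n + t by ring, k₃, k₂, nextLabel]
  by_cases h : t + 1 < n
  · rw [if_pos h, if_pos h, List.getD_append _ _ _ _ (by rw [List.length_tail, hlen]; omega),
      List.getD_eq_getElem?_getD, List.getElem?_tail, ← List.getD_eq_getElem?_getD, hrel _ h,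
      add_assoc, add_assoc]
    by_cases hp : row n W w = pivot n
    · have := ((row_eq_pivot hn).1 hp).2 (t + 1) (by omega) h
      rw [if_pos hp, this, decide_eq_true hp]
      cases W (d + (t + 1)) <;> rfl
    · rw [if_neg hp, decide_eq_false hp]
      cases W (d + (t + 1)) <;> cases W (w + (t + 1)) <;> rfl
  · rw [if_neg h, if_neg h, List.getD_append_right _ _ _ _ (by rw [List.length_tail, hlen]; omega),
      hone, List.length_tail, hlen, show t - (n - 1) = 0 by omega]
    cases decide (row n W w = pivot n) <;> rfl

theorem getD_flatten {n : ℕ} {L : List (List Bool)} (hL : ∀ a ∈ L, a.length = n) (l k : ℕ)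
    (hl : l < L.length) (hk : k < n) : L.flatten.getD (l * n + k) false = L[l].getD k false := by
  induction L generalizing l with
  | nil => simp at hl
  | cons a L ih =>
    have ha : a.length = n := hL a (by simp)
    rw [List.flatten_cons]
    cases l with
    | zero => rw [zero_mul, zero_add, List.getD_append _ _ _ _ (by omega)]; rfl
    | succ l =>
      rw [List.getD_append_right _ _ _ _ (by rw [Nat.succ_mul]; omega), ha,
        show (l + 1) * n + k - n = l * n + k by rw [Nat.succ_mul]; omega,
        ih (fun b hb => hL b (by simp [hb])) l (by simpa using hl)]
      rfl

theorem trace_append_singleton (n : ℕ) (ds : List (List Bool)) (d w : List Bool) :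
    trace n (ds ++ [d]) w = nextLabel n d (trace n ds w) := by
  simp [trace]

/-- The wires satisfy the gate equations, and induction on the round shows that row `(j, l)` of the
table carries the label of object `l` after the first `j` removals. The label removed in round `j`
is the diagonal entry `(j, j)`. -/
theorem choiceCircuit_eval {n : ℕ} {C : Circuit} (hn : 2 ≤ n) (hC : C.IsCircuit n n)
    {as : List (List Bool)} {x : List Bool} (hne : as ≠ []) (has : ∀ a ∈ as, a.length = n)
    (hx : x.length = n) :
    (choiceCircuit n C (as.length - 1)).eval (as ++ [x]).flatten = [choiceBit n C as x] := by
  have hpos : 0 < as.length := List.length_pos_iff.2 hne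
  set objs := as ++ [x] with hobjs
  have hlen : ∀ a ∈ objs, a.length = n := by
    intro a ha
    rcases List.mem_append.1 ha with ha | ha
    · exact has a ha
    · rw [List.mem_singleton.1 ha]; exact hx
  have hR : as.length - 1 + 2 = objs.length := by simp [hobjs]; omega
  rw [choiceCircuit, hR]
  set R := objs.length with hRl
  have hR2 : 2 ≤ R := by omega
  have hflat : objs.flatten.length = R * n := by
    rw [List.length_flatten, hRl]
    have : objs.map List.length = List.replicate objs.length n :=
      List.eq_replicate_iff.2 ⟨by simp, by simpa using hlen⟩
    rw [this]
    simp
  generalize hs : C.gates.length = s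
  have hWF := choiceGates_readsBelow hn hR2 hs.symm hC
  have hG := length_choiceGates (n := n) (R := R) hs.symm
  generalize hB : R * n + R * s + 1 = B at *
  generalize hm : R * n = m at *
  unfold Circuit.eval
  dsimp only
  rw [List.map_singleton]
  rw [← hflat] at hWF
  obtain ⟨hin, hsat⟩ := satisfies_wires hWF
  rw [hflat] at hin hsat
  generalize hW : (fun k => (wires (choiceGates n m s R B C)
    objs.flatten).getD k false) = W at *
  have hin : ∀ k < m, W k = objs.flatten.getD k false := by
    intro k hk
    rw [← hW]
    exact hin k hk
  rw [show (wires (choiceGates n m s R B C) objs.flatten).getD (cellBase n R B R 0 + 1) false =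
    W (cellBase n R B R 0 + 1) from congrFun hW _]
  rw [allGates_choiceGates hs.symm hB] at hsat
  obtain ⟨h₁, h₂, h₃, h₄, h₅⟩ := hsat
  have hone : W (m + R * s) = true := by
    rw [h₂]
    cases W 0 <;> rfl
  have hstart : ∀ l (hl : l < R), row n W (rowBase n R B 0 l) = C.eval objs[l] := by
    intro l hl
    have hl' : objs[l].length = n := hlen _ (List.getElem_mem _)
    -- Pulled back along `copyWire`, the wires of the large circuit solve the gate equations of `C`
    -- on input `objs[l]`.
    have hV := wires_eq_of_satisfies (gs := C.gates) (x := objs[l])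
      (V := fun a => W (copyWire n m s l a)) (by
        intro k g hk
        rw [hl']
        exact hC.1 k g hk) (by
        intro k hk
        rw [hl'] at hk
        have h := Nat.mul_le_mul_right n (Nat.succ_le_of_lt hl)
        rw [Nat.succ_mul, hm] at h
        rw [copyWire, if_pos hk, hin _ (by omega), getD_flatten hlen l k hl hk]) (by
        intro k g hk
        have := h₁ l hl k g hk
        unfold Satisfies at this ⊢
        beta_reduce
        rw [hl', show copyWire n m s l (n + k) = m + l * s + k by
          rw [copyWire, if_neg (by omega), Nat.add_sub_cancel_left], this]
        rfl)
    have hc := h₃ 0 (by omega) l hl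
    rw [cell, if_pos rfl, startCell, allGates_append, allGates_map_range, allGates_map_range] at hc
    have hlo : (C.eval objs[l]).length = n := by
      rw [Circuit.eval, List.length_map]; exact hC.2.2
    refine List.ext_getElem (by rw [hlo]; simp [row]) fun t ht ht' => ?_
    rw [hlo] at ht'
    have hto : t < C.outputs.length := by rw [hC.2.2]; exact ht'
    rw [← List.getD_eq_getElem _ false, getD_row ht']
    have := hc.2 t ht'
    rw [List.length_map, List.length_range] at this
    unfold Satisfies at this
    rw [rowBase, this]
    dsimp only
    simp only [Circuit.eval, List.getElem_map]
    rw [hV _ (by rw [hl']; exact hC.2.1 _ (List.getElem_mem _)), List.getD_eq_getElem _ _ hto]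
    cases W (copyWire n m s l C.outputs[t]) <;> rfl
  have hstep : ∀ j, j + 1 < R → ∀ l < R,
      W (cellBase n R B (j + 1) l + n - 1) = decide (row n W (rowBase n R B j l) = pivot n) ∧
      row n W (rowBase n R B (j + 1) l) =
        nextLabel n (row n W (rowBase n R B j j)) (row n W (rowBase n R B j l)) := by
    intro j hj l hl
    have hc := h₃ (j + 1) hj l hl
    rw [cell, if_neg (Nat.succ_ne_zero j), Nat.add_sub_cancel] at hc
    exact nextCell_correct (by omega) hone hc
  have hrow : ∀ j (hj : j < R) l (hl : l < R), row n W (rowBase n R B j l) =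
      trace n (pivots n C (objs.take j)) (C.eval objs[l]) := by
    intro j
    induction j with
    | zero => exact fun hj l hl => hstart l hl
    | succ j ih =>
      intro hj l hl
      rw [(hstep j hj l hl).2, ih (by omega) l hl, ih (by omega) j (by omega),
        ← List.take_append_getElem (show j < objs.length by omega), pivots_append_singleton,
        trace_append_singleton]
  have hhead : ∀ b, (row n W b).headD false = W b := by
    intro b
    obtain ⟨n, rfl⟩ := Nat.exists_eq_add_of_le' (show 1 ≤ n by omega)
    rw [row, List.range_succ_eq_map]
    rfl
  have hi : R - 2 + 1 = R - 1 := by omega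
  have htake : objs.take (R - 2) = as.dropLast := by
    rw [List.dropLast_eq_take, hobjs, List.take_append_of_le_length (by omega)]
    congr 1
    omega
  have hl₁ : objs[R - 2]'(by omega) = as.getLastD [] := by
    rw [List.getLastD_eq_getLast?, List.getLast?_eq_getElem?, List.getElem?_eq_getElem (by omega)]
    simp only [hobjs]
    rw [List.getElem_append_left (by omega)]
    congr 1
    omega
  have hl₂ : objs[R - 1]'(by omega) = x := by
    simp only [hobjs]
    rw [List.getElem_append_right (by omega)]
    simp
  have hd := hrow (R - 2) (by omega) (R - 2) (by omega)
  have hw := hrow (R - 2) (by omega) (R - 1) (by omega)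
  have hp := (hstep (R - 2) (by omega) (R - 1) (by omega)).1
  rw [htake, hl₁] at hd
  rw [htake, hl₂] at hw
  rw [hi] at hp
  unfold Satisfies at h₄ h₅
  dsimp only at h₄ h₅
  rw [hp] at h₄
  rw [h₅, h₄, choiceBit, ← hd, ← hw, labelBit, relabel]
  congr 1
  split_ifs with hpv
  · rw [decide_eq_true hpv, hhead, ((row_eq_pivot (by omega)).1 hpv).1]
    cases W (rowBase n R B (R - 2) (R - 2)) <;> rfl
  · rw [decide_eq_false hpv, hhead]
    cases W (rowBase n R B (R - 2) (R - 2)) <;>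
      cases W (rowBase n R B (R - 2) (R - 1)) <;> rfl

end ShortChoice

namespace ShortChoice

/-- The predicates of the instance of Short Choice that is obtained from the circuit `C`. -/
def choicePredicates (n : ℕ) (C : Circuit) : List Circuit :=
  (List.range (n - 1)).map (choiceCircuit n C)

theorem choicePredicates_isInstance {n : ℕ} {C : Circuit} (hn : 2 ≤ n) (hC : C.IsCircuit n n) :
    IsInstance n (choicePredicates n C) := by
  refine ⟨hn, by simp [choicePredicates], fun i Q hQ => ?_⟩
  rw [choicePredicates, List.getElem?_map, Option.map_eq_some_iff] at hQ
  obtain ⟨j, hj, rfl⟩ := hQ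
  obtain rfl : i = j := by
    rw [List.getElem?_eq_some_iff] at hj
    simpa using hj.2
  exact choiceCircuit_isCircuit hn hC _

theorem represents_choicePredicates {n : ℕ} {C : Circuit} (hn : 2 ≤ n) (hC : C.IsCircuit n n) :
    Represents n C (choicePredicates n C) := by
  intro as x hne hlen has hx
  have hpos : 0 < as.length := List.length_pos_iff.2 hne
  have : (choicePredicates n C).getD (as.length - 1) ⟨[], []⟩ = choiceCircuit n C (as.length - 1) := by
    simp [choicePredicates, show as.length - 1 < n - 1 by omega]
  rw [predVal, this]
  exact choiceCircuit_eval hn hC hne has hx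

end ShortChoice

/-! ### Polynomial-time computability of the reduction. -/

namespace ShortChoice

open Turing Function Polynomial
open Enc (enc)

variable {α β γ : Type} [Enc α] [Enc β] [Enc γ]

/-! ### Computing with circuits -/

/-- The fields of a gate. -/
def Gate.toProd (g : Gate) : Bool × Bool × Bool × Bool × ℕ × ℕ :=
  (g.t00, g.t01, g.t10, g.t11, g.fst, g.snd)

/-- The fields of a circuit. -/
def Circuit.toProd (C : Circuit) : List Gate × List ℕ := (C.gates, C.outputs)

instance : Enc Gate := ⟨fun g => enc g.toProd⟩
instance : Enc Circuit := ⟨fun C => enc C.toProd⟩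

theorem PT.gate_toProd : PT Gate.toProd := .of_str .id fun _ => rfl
theorem PT.circuit_toProd : PT Circuit.toProd := .of_str .id fun _ => rfl

@[fun_prop]
theorem PT.t00 {f : α → Gate} (hf : PT f) : PT fun a => (f a).t00 :=
  (PT.gate_toProd.comp hf).fst

@[fun_prop]
theorem PT.t01 {f : α → Gate} (hf : PT f) : PT fun a => (f a).t01 :=
  (PT.gate_toProd.comp hf).snd.fst

@[fun_prop]
theorem PT.t10 {f : α → Gate} (hf : PT f) : PT fun a => (f a).t10 :=
  (PT.gate_toProd.comp hf).snd.snd.fst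

@[fun_prop]
theorem PT.t11 {f : α → Gate} (hf : PT f) : PT fun a => (f a).t11 :=
  (PT.gate_toProd.comp hf).snd.snd.snd.fst

@[fun_prop]
theorem PT.gate_fst {f : α → Gate} (hf : PT f) : PT fun a => (f a).fst :=
  (PT.gate_toProd.comp hf).snd.snd.snd.snd.fst

@[fun_prop]
theorem PT.gate_snd {f : α → Gate} (hf : PT f) : PT fun a => (f a).snd :=
  (PT.gate_toProd.comp hf).snd.snd.snd.snd.snd

@[fun_prop]
theorem PT.gate_mk {a b c d : α → Bool} {i j : α → ℕ} (ha : PT a) (hb : PT b) (hc : PT c)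
    (hd : PT d) (hi : PT i) (hj : PT j) :
    PT fun x => Gate.mk (a x) (b x) (c x) (d x) (i x) (j x) := by
  have h : PT fun p : Bool × Bool × Bool × Bool × ℕ × ℕ =>
      Gate.mk p.1 p.2.1 p.2.2.1 p.2.2.2.1 p.2.2.2.2.1 p.2.2.2.2.2 := .of_str .id fun _ => rfl
  exact h.comp (f := fun x => (a x, b x, c x, d x, i x, j x)) (by fun_prop)

@[fun_prop]
theorem PT.gates {f : α → Circuit} (hf : PT f) : PT fun a => (f a).gates :=
  (PT.circuit_toProd.comp hf).fst

@[fun_prop]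
theorem PT.outputs {f : α → Circuit} (hf : PT f) : PT fun a => (f a).outputs :=
  (PT.circuit_toProd.comp hf).snd

@[fun_prop]
theorem PT.circuit_mk {g : α → List Gate} {o : α → List ℕ} (hg : PT g) (ho : PT o) :
    PT fun x => Circuit.mk (g x) (o x) := by
  have h : PT fun p : List Gate × List ℕ => Circuit.mk p.1 p.2 := .of_str .id fun _ => rfl
  exact h.comp (f := fun x => (g x, o x)) (by fun_prop)

@[fun_prop]
theorem PT.gate_fn {g : α → Gate} {a b : α → Bool} (hg : PT g) (ha : PT a) (hb : PT b) :
    PT fun x => (g x).fn (a x) (b x) := by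
  have h : PT fun x => bif a x then (bif b x then (g x).t11 else (g x).t10) else
    (bif b x then (g x).t01 else (g x).t00) := by fun_prop
  exact h.of_eq fun x => by cases a x <;> cases b x <;> rfl

@[fun_prop]
theorem PT.wires {g : α → List Gate} {x : α → List Bool} (hg : PT g) (hx : PT x) :
    PT fun a => wires (g a) (x a) := by
  unfold ShortChoice.wires
  exact PT.foldl (step := fun _ w g => w ++ [g.fn (w.getD g.fst false) (w.getD g.snd false)])
    hg hx (by fun_prop) 3 fun a s b => by simp

@[fun_prop]
theorem PT.eval {C : α → Circuit} {x : α → List Bool} (hC : PT C) (hx : PT x) :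
    PT fun a => (C a).eval (x a) := by
  unfold Circuit.eval
  exact PT.map (f := fun a i => (ShortChoice.wires (C a).gates (x a)).getD i false) (by fun_prop)
    (by fun_prop)

/-! ### Computing the reduction -/

@[fun_prop]
theorem PT.copyWire {n m s l a : α → ℕ} (hn : PT n) (hm : PT m) (hs : PT s) (hl : PT l)
    (ha : PT a) : PT fun x => copyWire (n x) (m x) (s x) (l x) (a x) := by
  unfold ShortChoice.copyWire
  fun_prop

@[fun_prop]
theorem PT.cellBase {n R B j l : α → ℕ} (hn : PT n) (hR : PT R) (hB : PT B) (hj : PT j)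
    (hl : PT l) : PT fun x => cellBase (n x) (R x) (B x) (j x) (l x) := by
  unfold ShortChoice.cellBase
  fun_prop

@[fun_prop]
theorem PT.rowBase {n R B j l : α → ℕ} (hn : PT n) (hR : PT R) (hB : PT B) (hj : PT j)
    (hl : PT l) : PT fun x => rowBase (n x) (R x) (B x) (j x) (l x) := by
  unfold ShortChoice.rowBase
  fun_prop

@[fun_prop]
theorem PT.copyGate {n m s l : α → ℕ} {g : α → Gate} (hn : PT n) (hm : PT m) (hs : PT s)
    (hl : PT l) (hg : PT g) : PT fun x => copyGate (n x) (m x) (s x) (l x) (g x) := by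
  unfold ShortChoice.copyGate
  fun_prop

@[fun_prop]
theorem PT.startCell {n m s l : α → ℕ} {o : α → List ℕ} (hn : PT n) (hm : PT m) (hs : PT s)
    (hl : PT l) (ho : PT o) : PT fun x => startCell (n x) (m x) (s x) (l x) (o x) := by
  unfold ShortChoice.startCell
  refine PT.append (PT.map (by fun_prop) (by fun_prop)) (PT.map (by fun_prop) (by fun_prop))

@[fun_prop]
theorem PT.nextCell {n one c d w : α → ℕ} (hn : PT n) (ho : PT one) (hc : PT c)
    (hd : PT d) (hw : PT w) : PT fun x => nextCell (n x) (one x) (c x) (d x) (w x) := by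
  unfold ShortChoice.nextCell
  refine PT.append (PT.map (by fun_prop) (by fun_prop))
    (PT.append (PT.map (by fun_prop) (by fun_prop)) (PT.map (by fun_prop) (by fun_prop)))

@[fun_prop]
theorem PT.cell {n m s R B j l : α → ℕ} {o : α → List ℕ} (hn : PT n) (hm : PT m) (hs : PT s)
    (hR : PT R) (hB : PT B) (ho : PT o) (hj : PT j) (hl : PT l) :
    PT fun x => cell (n x) (m x) (s x) (R x) (B x) (o x) (j x) (l x) := by
  unfold ShortChoice.cell
  fun_prop

@[fun_prop]
theorem PT.choiceGates {n m s R B : α → ℕ} {C : α → Circuit} (hn : PT n) (hm : PT m) (hs : PT s)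
    (hR : PT R) (hB : PT B) (hC : PT C) :
    PT fun x => choiceGates (n x) (m x) (s x) (R x) (B x) (C x) := by
  unfold ShortChoice.choiceGates
  refine PT.append (PT.flatMap (by fun_prop) (PT.map (by fun_prop) (by fun_prop)))
    (PT.cons (by fun_prop) (PT.append (PT.flatMap (by fun_prop) (PT.flatMap (by fun_prop)
      (by fun_prop))) (by fun_prop)))

@[fun_prop]
theorem PT.choiceCircuit {n i : α → ℕ} {C : α → Circuit} (hn : PT n) (hC : PT C) (hi : PT i) :
    PT fun x => choiceCircuit (n x) (C x) (i x) := by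
  unfold ShortChoice.choiceCircuit
  fun_prop

@[fun_prop]
theorem PT.choicePredicates {n : α → ℕ} {C : α → Circuit} (hn : PT n) (hC : PT C) :
    PT fun x => choicePredicates (n x) (C x) := by
  unfold ShortChoice.choicePredicates
  exact PT.map (by fun_prop) (by fun_prop)

@[simp] theorem length_enc_listBool (l : List Bool) : (enc l).length = 3 * l.length := by
  induction l with
  | nil => rfl
  | cons b l ih => simp [ih]; omega

@[fun_prop]
theorem PT.decide_eq_listBool {f g : α → List Bool} (hf : PT f) (hg : PT g) :
    PT fun a => decide (f a = g a) := by
  have h : PT fun a => decide ((f a).length = (g a).length) &&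
      (List.range (f a).length).all fun i => (f a).getD i false == (g a).getD i false :=
    PT.and (by fun_prop) (PT.all (by fun_prop) (by fun_prop))
  refine h.of_eq fun a => ?_
  rw [Bool.eq_iff_iff]
  simp only [Bool.and_eq_true, decide_eq_true_iff, List.all_eq_true, List.mem_range, beq_iff_eq]
  refine ⟨fun ⟨h₁, h₂⟩ => List.ext_getElem h₁ fun i hi hi' => ?_, fun h => ⟨by rw [h], by simp [h]⟩⟩
  have := h₂ i hi
  rwa [List.getD_eq_getElem _ _ hi, List.getD_eq_getElem _ _ hi'] at this

@[fun_prop]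
theorem PT.pivot {n : α → ℕ} (hn : PT n) : PT fun a => pivot (n a) := by
  unfold ShortChoice.pivot
  fun_prop

@[fun_prop]
theorem PT.relabel {n : α → ℕ} {d w : α → List Bool} (hn : PT n) (hd : PT d) (hw : PT w) :
    PT fun a => relabel (n a) (d a) (w a) := by
  unfold ShortChoice.relabel
  fun_prop

@[fun_prop]
theorem PT.nextLabel {n : α → ℕ} {d w : α → List Bool} (hn : PT n) (hd : PT d) (hw : PT w) :
    PT fun a => nextLabel (n a) (d a) (w a) := by
  unfold ShortChoice.nextLabel
  fun_prop

@[fun_prop]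
theorem PT.labelBit {n : α → ℕ} {d w : α → List Bool} (hn : PT n) (hd : PT d) (hw : PT w) :
    PT fun a => labelBit (n a) (d a) (w a) := by
  unfold ShortChoice.labelBit
  fun_prop

@[fun_prop]
theorem PT.prevLabel {n : α → ℕ} {b : α → Bool} {d w : α → List Bool} (hn : PT n) (hd : PT d)
    (hb : PT b) (hw : PT w) : PT fun a => prevLabel (n a) (d a) (b a) (w a) := by
  unfold ShortChoice.prevLabel
  fun_prop

/-- Size bounds must hold for arbitrary strings, not just for labels of length `n`. -/
theorem length_nextLabel_le (n : ℕ) (d w : List Bool) :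
    (nextLabel n d w).length ≤ max (max d.length w.length) 1 := by
  unfold nextLabel relabel
  split_ifs <;> simp <;> omega

@[fun_prop]
theorem PT.trace {n : α → ℕ} {ds : α → List (List Bool)} {w : α → List Bool} (hn : PT n)
    (hd : PT ds) (hw : PT w) : PT fun a => trace (n a) (ds a) (w a) := by
  unfold ShortChoice.trace
  exact PT.foldl (step := fun a w d => ShortChoice.nextLabel (n a) d w) hd hw (by fun_prop) (X + 3)
    fun a s b => by
      have := length_nextLabel_le (n a) b s
      simp
      omega

theorem length_trace_le (n : ℕ) {ds : List (List Bool)} {w : List Bool} {K : ℕ} (hK : 1 ≤ K)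
    (hd : ∀ d ∈ ds, d.length ≤ K) (hw : w.length ≤ K) : (trace n ds w).length ≤ K := by
  induction ds generalizing w with
  | nil => exact hw
  | cons d ds ih =>
    refine ih (fun e he => hd e (by simp [he])) ?_
    have h₁ := length_nextLabel_le n d w
    have h₂ := hd d (by simp)
    beta_reduce
    omega

theorem length_enc_le_of_forall {L : List (List Bool)} {K : ℕ} (h : ∀ d ∈ L, d.length ≤ K) :
    (enc L).length ≤ L.length * (6 * K + 1) := by
  induction L with
  | nil => simp
  | cons d L ih =>
    have h₁ := h d (by simp)
    have h₂ := ih fun e he => h e (by simp [he])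
    rw [length_enc_cons, length_enc_listBool, List.length_cons, Nat.add_mul]
    omega

-- The entry added in a step depends on the accumulator, so `PT.foldl` does not apply. However,
-- every entry has length at most `z + 1`, with `z` the size of the data, because `trace` preserves
-- such a bound and the outputs of `C` obey it.
@[fun_prop]
theorem PT.pivots {n : α → ℕ} {C : α → Circuit} {as : α → List (List Bool)} (hn : PT n)
    (hC : PT C) (has : PT as) : PT fun a => pivots (n a) (C a) (as a) := by
  suffices h : PT fun p : (ℕ × Circuit) × List (List Bool) => ShortChoice.pivots p.1.1 p.1.2 p.2 from
    h.comp (f := fun a => ((n a, C a), as a)) (by fun_prop)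
  refine PT.foldl_of_le (α := (ℕ × Circuit) × List (List Bool))
    (step := fun p ds a => ds ++ [ShortChoice.trace p.1.1 ds (p.1.2.eval a)])
    (by fun_prop) (PT.const []) (by fun_prop) ((X + X) * (6 * (X + 1) + 1)) fun p l s i => ?_
  obtain ⟨⟨n, C⟩, L⟩ := p
  generalize hz : (enc (((n, C), L), l, s)).length = z
  have hzs : (enc s).length ≤ z := by rw [← hz]; simp; omega
  have hzl : (enc l).length ≤ z := by rw [← hz]; simp; omega
  have hzC : C.outputs.length ≤ z := by
    have h₁ := length_le_enc C.outputs
    have h₂ : (enc C).length = 2 * (enc C.gates).length + (enc C.outputs).length + 1 :=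
      length_enc_prod C.gates C.outputs
    rw [← hz]; simp; omega
  have key : ∀ l' : List (List Bool), ∀ d ∈ l'.foldl (fun ds a =>
      ds ++ [ShortChoice.trace n ds (C.eval a)]) s, d.length ≤ z + 1 := by
    intro l'
    induction l' using List.reverseRecOn with
    | nil =>
      intro d hd
      have := length_enc_mem (show d ∈ s from hd)
      rw [length_enc_listBool] at this
      omega
    | append_singleton l' a ih =>
      rw [List.foldl_append]
      intro d hd
      rcases List.mem_append.1 hd with hd | hd
      · exact ih d hd
      · rw [List.mem_singleton.1 hd]
        refine length_trace_le n (by omega) ih ?_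
        rw [Circuit.eval, List.length_map]
        omega
  have key' : ∀ l' : List (List Bool), (l'.foldl (fun ds a =>
      ds ++ [ShortChoice.trace n ds (C.eval a)]) s).length = s.length + l'.length := by
    intro l'
    induction l' using List.reverseRecOn with
    | nil => rfl
    | append_singleton l' a ih =>
      rw [List.foldl_append, List.foldl_cons, List.foldl_nil, List.length_append, ih]
      simp
      omega
  refine (length_enc_le_of_forall (key _)).trans ?_
  rw [key']
  simp only [eval_mul, eval_add, eval_X, eval_one, eval_ofNat]
  refine Nat.mul_le_mul ?_ le_rfl
  have h₁ := length_le_enc s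
  have h₂ := length_le_enc l
  rw [List.length_take]
  omega

@[fun_prop]
theorem PT.getLastD {f : α → List β} (hf : PT f) (d : β) : PT fun a => (f a).getLastD d := by
  have h : PT fun a => (f a).reverse.headD d := by fun_prop
  exact h.of_eq fun a => by simp [List.getLastD_eq_getLast?, List.headD_eq_head?_getD]

@[fun_prop]
theorem PT.choiceBit {n : α → ℕ} {C : α → Circuit} {as : α → List (List Bool)} {x : α → List Bool}
    (hn : PT n) (hC : PT C) (has : PT as) (hx : PT x) :
    PT fun a => choiceBit (n a) (C a) (as a) (x a) := by
  unfold ShortChoice.choiceBit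
  fun_prop

@[fun_prop]
theorem PT.choiceBits {n : α → ℕ} {C : α → Circuit} {as : α → List (List Bool)} {c : α → Bool}
    (hn : PT n) (hC : PT C) (has : PT as) (hc : PT c) :
    PT fun a => choiceBits (n a) (C a) (as a) (c a) := by
  unfold ShortChoice.choiceBits
  exact PT.append (PT.map (by fun_prop) (by fun_prop)) (by fun_prop)

@[fun_prop]
theorem PT.target {n k : α → ℕ} (hn : PT n) (hk : PT k) : PT fun a => target (n a) (k a) := by
  unfold ShortChoice.target
  fun_prop

@[fun_prop]
theorem PT.untrace {n : α → ℕ} {L : α → List (List Bool × Bool)} {u : α → List Bool} (hn : PT n)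
    (hL : PT L) (hu : PT u) : PT fun a => untrace (n a) (L a) (u a) := by
  have h : PT fun a => (L a).reverse.foldl
      (fun u (p : List Bool × Bool) => ShortChoice.prevLabel (n a) p.1 p.2 u) (u a) := by
    obtain ⟨q, hq⟩ := hn.size
    refine PT.foldl (step := fun a u (p : List Bool × Bool) => ShortChoice.prevLabel (n a) p.1 p.2 u) (by fun_prop) hu
      (by fun_prop) (3 * q + 3) fun a s b => ?_
    have h₁ := hq a
    have h₂ := eval_mono q (show (enc a).length ≤ (enc a).length + (enc b).length by omega)
    rw [length_enc_nat] at h₁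
    rw [length_enc_listBool, length_enc_listBool]
    simp only [eval_add, eval_mul, eval_ofNat]
    unfold ShortChoice.prevLabel
    split_ifs
    · simp [ShortChoice.pivot]; omega
    · simp; omega
  exact h.of_eq fun a => by rw [List.foldl_reverse]; rfl

@[fun_prop]
theorem PT.solution {n : α → ℕ} {C : α → Circuit} {as : α → List (List Bool)} {c : α → Bool}
    (hn : PT n) (hC : PT C) (has : PT as) (hc : PT c) :
    PT fun a => solution (n a) (C a) (as a) (c a) := by
  have h : PT fun a => ShortChoice.untrace (n a) ((List.range (as a).length).map fun i =>
      ((ShortChoice.pivots (n a) (C a) (as a)).getD i [],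
        (ShortChoice.choiceBits (n a) (C a) (as a) (c a)).getD i false))
      (ShortChoice.target (n a) (as a).length) :=
    PT.untrace hn (PT.map (by fun_prop) (by fun_prop)) (by fun_prop)
  refine h.of_eq fun a => ?_
  rw [ShortChoice.solution]
  congr 1
  -- For `as = []` there is one choice bit but no removed label, so the zipped list has `as.length`
  -- entries in this case too.
  refine List.ext_getElem (by simp [ShortChoice.choiceBits]; omega) fun i hi hi' => ?_
  have h₁ : i < (as a).length := by simpa using hi
  simp only [List.getElem_map, List.getElem_range, List.getElem_zip]
  rw [List.getD_eq_getElem, List.getD_eq_getElem]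

end ShortChoice

/-! ### Encoders and parsers. -/

namespace ShortChoice

open Turing Function Polynomial
open Enc (enc)

variable {α β γ : Type} [Enc α] [Enc β] [Enc γ]

/-! ### Writing and reading the codes of the search problems -/

@[fun_prop]
theorem PT.encNat {f : α → ℕ} (hf : PT f) : PT fun a => encNat (f a) := by
  unfold ShortChoice.encNat
  fun_prop

theorem PT.encList {e : β → List Bool} {f : α → List β} (he : PT e) (hf : PT f) :
    PT fun a => encList e (f a) := by
  unfold ShortChoice.encList
  exact PT.append (PT.flatMap hf (PT.cons (PT.const true) (he.comp PT.snd'))) (PT.const [false])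

@[fun_prop]
theorem PT.encGate {f : α → Gate} (hf : PT f) : PT fun a => encGate (f a) := by
  unfold ShortChoice.encGate
  fun_prop

@[fun_prop]
theorem PT.encCircuit {f : α → Circuit} (hf : PT f) : PT fun a => encCircuit (f a) := by
  unfold ShortChoice.encCircuit
  exact PT.append (PT.encList (PT.encGate PT.id) (by fun_prop))
    (PT.encList (PT.encNat PT.id) (by fun_prop))

@[fun_prop]
theorem PT.encInstance {n : α → ℕ} {P : α → List Circuit} (hn : PT n) (hP : PT P) :
    PT fun a => encInstance (n a) (P a) := by
  unfold ShortChoice.encInstance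
  exact PT.append (by fun_prop) (PT.encList (PT.encCircuit PT.id) hP)

instance : Enc Unit := ⟨fun _ => []⟩

/-- `r` reads an element, coded by `e`, from the front of a bit string. -/
structure Reads (r : List Bool → α × List Bool) (e : α → List Bool) : Prop where
  computable : PT r
  length_le : ∀ l, (r l).2.length ≤ l.length
  read : ∀ a l, r (e a ++ l) = (a, l)

namespace Reads

theorem bit : Reads (fun l => (l.headD false, l.tail)) fun b => [b] where
  computable := by fun_prop
  length_le l := by simp
  read a l := rfl

theorem nothing : Reads (fun l => ((), l)) fun _ : Unit => [] where
  computable := by fun_prop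
  length_le l := le_rfl
  read a l := rfl

theorem prod {r : List Bool → α × List Bool} {r' : List Bool → β × List Bool}
    {e : α → List Bool} {e' : β → List Bool} (h : Reads r e) (h' : Reads r' e') :
    Reads (fun l => (((r l).1, (r' (r l).2).1), (r' (r l).2).2)) fun p => e p.1 ++ e' p.2 where
  computable := by
    have h₁ := h.computable
    have h₂ := h'.computable
    fun_prop
  length_le l := (h'.length_le _).trans (h.length_le l)
  read p l := by simp only [List.append_assoc, h.read, h'.read]

theorem map {r : List Bool → α × List Bool} {e : α → List Bool} (h : Reads r e) {f : α → β}
    (hf : PT f) {e' : β → List Bool} (g : β → α) (hg : ∀ b, f (g b) = b)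
    (he : ∀ b, e' b = e (g b)) : Reads (fun l => (f (r l).1, (r l).2)) e' where
  computable := by
    have h₁ := h.computable
    fun_prop
  length_le l := h.length_le l
  read b l := by simp only [he, h.read, hg]

/-- Read one more entry of a list. -/
def listStep (r : List Bool → α × List Bool) (p : List α × List Bool) : List α × List Bool :=
  bif p.2.headD false then (p.1 ++ [(r p.2.tail).1], (r p.2.tail).2) else p

/-- The end mark `false` is a fixed point of `listStep`, so surplus iterations do no harm and the
length of the input can serve as their number. -/
theorem listStep_encList {r : List Bool → α × List Bool} {e : α → List Bool} (h : Reads r e)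
    (t : List Bool) (L acc : List α) (k : ℕ) (hk : L.length ≤ k) :
    (listStep r)^[k] (acc, encList e L ++ t) = (acc ++ L, false :: t) := by
  induction L generalizing acc k with
  | nil =>
    have e : listStep r (acc, false :: t) = (acc, false :: t) := rfl
    simpa [encList] using iterate_fixed e k
  | cons a L ih =>
    obtain ⟨k, rfl⟩ := Nat.exists_eq_add_of_le' (show 1 ≤ k by simp at hk; omega)
    have e₁ : encList e (a :: L) ++ t = true :: (e a ++ (encList e L ++ t)) := by simp [encList]
    have e₂ : listStep r (acc, true :: (e a ++ (encList e L ++ t))) =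
        (acc ++ [(r (e a ++ (encList e L ++ t))).1], (r (e a ++ (encList e L ++ t))).2) := rfl
    rw [iterate_succ_apply, e₁, e₂, h.read, ih _ _ (by simpa using hk)]
    simp

/-- The unread part never grows, so every entry is read from a string no longer than the initial
one, which bounds all entries uniformly. The factor 3 is the size of a bit in a coded list. -/
theorem listStep_bounds {r : List Bool → α × List Bool} {e : α → List Bool} (h : Reads r e)
    {q : ℕ[X]} (hq : ∀ l, (enc (r l).1).length ≤ q.eval (enc l).length) (p : List α × List Bool)
    (i : ℕ) : ((listStep r)^[i] p).2.length ≤ p.2.length ∧ (enc ((listStep r)^[i] p).1).length ≤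
      (enc p.1).length + i * (2 * q.eval (3 * p.2.length) + 1) := by
  induction i with
  | zero => simp
  | succ i ih =>
    rw [iterate_succ_apply']
    generalize (listStep r)^[i] p = s at ih
    rw [Nat.succ_mul]
    unfold listStep
    cases s.2.headD false
    · exact ⟨ih.1, by rw [cond_false]; omega⟩
    · have h₁ := h.length_le s.2.tail
      have h₂ := hq s.2.tail
      have h₃ : s.2.tail.length ≤ p.2.length := by simp; omega
      rw [length_enc_listBool] at h₂
      have h₄ := eval_mono q (Nat.mul_le_mul_left 3 h₃)
      simp only [cond_true]
      refine ⟨by omega, ?_⟩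
      simp
      omega

theorem list {r : List Bool → α × List Bool} {e : α → List Bool} (h : Reads r e) :
    Reads (fun l => (((listStep r)^[l.length] ([], l)).1, ((listStep r)^[l.length] ([], l)).2.tail))
      (encList e) where
  computable := by
    have h₁ := h.computable
    obtain ⟨q, hq⟩ := h₁.fst.size
    have h₂ : PT (listStep r) := by
      unfold listStep
      fun_prop
    have h₃ := PT.iterate h₂ (2 * (X + X * (2 * q.comp (3 * X) + 1)) + 3 * X + 1) fun n p i hi => by
      obtain ⟨b₁, b₂⟩ := listStep_bounds h hq p i
      have h₄ : p.2.length ≤ (enc (n, p)).length := by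
        obtain ⟨a, b⟩ := p
        simp; omega
      have h₅ : (enc p.1).length ≤ (enc (n, p)).length := by
        obtain ⟨a, b⟩ := p
        simp; omega
      have h₆ : i ≤ (enc (n, p)).length := by simp; omega
      generalize (enc (n, p)).length = z at *
      have h₇ := Nat.mul_le_mul h₆
        (Nat.add_le_add_right (Nat.mul_le_mul_left 2 (eval_mono q (Nat.mul_le_mul_left 3 h₄))) 1)
      generalize (listStep r)^[i] p = s at *
      obtain ⟨s, t⟩ := s
      dsimp only at b₁ b₂
      rw [length_enc_prod, length_enc_listBool]
      simp only [eval_add, eval_mul, eval_X, eval_one, eval_ofNat, eval_comp]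
      omega
    have h₈ : PT fun l : List Bool => (listStep r)^[l.length] ([], l) :=
      h₃.comp (f := fun l : List Bool => (l.length, (([] : List α), l))) (by fun_prop)
    fun_prop
  length_le l := by
    obtain ⟨q, hq⟩ := h.computable.fst.size
    have := (listStep_bounds h hq ([], l) l.length).1
    rw [List.length_tail]
    exact (Nat.sub_le _ _).trans this
  read L t := by
    have hL : L.length ≤ (encList e L ++ t).length := by
      have : L.length ≤ (L.flatMap fun a => true :: e a).length := by
        induction L with
        | nil => simp
        | cons a L ih => simp at ih ⊢; omega
      simp only [encList, List.length_append]
      omega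
    rw [listStep_encList h t L [] _ hL]
    rfl

end Reads

/-- A unary number is the code of a list of units, each with empty code. -/
theorem exists_reads_nat : ∃ r, Reads r encNat :=
  ⟨_, Reads.nothing.list.map (f := List.length) (PT.length PT.id) (fun n => List.replicate n ())
    (fun n => by simp) fun n => by
      simp [encNat, encList, List.flatMap_def, List.map_replicate, List.flatten_replicate_singleton]⟩

theorem exists_reads_gate : ∃ r, Reads r encGate := by
  obtain ⟨r, hr⟩ := exists_reads_nat
  refine ⟨_, (Reads.bit.prod (Reads.bit.prod (Reads.bit.prod (Reads.bit.prod
    (hr.prod hr))))).map (f := fun p => Gate.mk p.1 p.2.1 p.2.2.1 p.2.2.2.1 p.2.2.2.2.1 p.2.2.2.2.2)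
    (by fun_prop) Gate.toProd (fun g => rfl) fun g => ?_⟩
  simp [encGate, Gate.toProd]

theorem exists_reads_circuit : ∃ r, Reads r encCircuit := by
  obtain ⟨r, hr⟩ := exists_reads_nat
  obtain ⟨r', hr'⟩ := exists_reads_gate
  exact ⟨_, (hr'.list.prod hr.list).map (f := fun p => Circuit.mk p.1 p.2) (by fun_prop)
    Circuit.toProd (fun C => rfl) fun C => rfl⟩

theorem exists_reads_empty : ∃ r, Reads r fun p : ℕ × Circuit => encEmpty p.1 p.2 := by
  obtain ⟨r, hr⟩ := exists_reads_nat
  obtain ⟨r', hr'⟩ := exists_reads_circuit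
  exact ⟨_, hr.prod hr'⟩

/-! ### The certificate as a sequence of objects -/

/-- Cut a bit string into strings of length `n`. -/
def chunks (n : ℕ) (y : List Bool) : List (List Bool) :=
  (List.range y.length).flatMap fun i => if i * n < y.length then [(y.drop (i * n)).take n] else []

@[fun_prop]
theorem PT.chunks {n : α → ℕ} {y : α → List Bool} (hn : PT n) (hy : PT y) :
    PT fun a => chunks (n a) (y a) := by
  unfold ShortChoice.chunks
  exact PT.flatMap (by fun_prop) (by fun_prop)

theorem take_drop_flatten {n : ℕ} {L : List (List Bool)} (hL : ∀ a ∈ L, a.length = n) (i : ℕ)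
    (hi : i < L.length) : (L.flatten.drop (i * n)).take n = L[i] := by
  induction L generalizing i with
  | nil => simp at hi
  | cons a L ih =>
    have ha : a.length = n := hL a (by simp)
    cases i with
    | zero => simp [← ha]
    | succ i =>
      rw [List.flatten_cons, Nat.succ_mul, add_comm, ← List.drop_drop, List.drop_left' ha,
        ih (fun b hb => hL b (by simp [hb])) i (by simpa using hi)]
      rfl

/-- For `n ≥ 1` the length of the string is at least the number of pieces; the surplus indices
contribute nothing. -/
theorem chunks_flatten {n : ℕ} (hn : 1 ≤ n) {L : List (List Bool)} (hL : ∀ a ∈ L, a.length = n) :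
    chunks n L.flatten = L := by
  have hlen : L.flatten.length = L.length * n := by
    have : L.map List.length = List.replicate L.length n :=
      List.eq_replicate_iff.2 ⟨by simp, by simpa using hL⟩
    rw [List.length_flatten, this]
    simp
  have key : ∀ d, (List.range (L.length + d)).flatMap (fun i =>
      if i * n < L.flatten.length then [(L.flatten.drop (i * n)).take n] else []) = L := by
    intro d
    induction d with
    | zero =>
      have : ∀ k ≤ L.length, (List.range k).flatMap (fun i => if i * n < L.flatten.length then
          [(L.flatten.drop (i * n)).take n] else []) = L.take k := by
        intro k
        induction k with
        | zero => simp
        | succ k ih =>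
          intro hk
          rw [List.range_succ, List.flatMap_append, ih (by omega), List.flatMap_singleton, if_pos,
            take_drop_flatten hL k hk, List.take_append_getElem]
          rw [hlen]
          exact Nat.mul_lt_mul_of_pos_right hk hn
      simpa using this L.length le_rfl
    | succ d ih =>
      rw [← add_assoc, List.range_succ, List.flatMap_append, ih, List.flatMap_singleton, if_neg,
        List.append_nil]
      rw [hlen, not_lt]
      exact Nat.mul_le_mul_right n (by omega)
  have := key (L.length * n - L.length)
  rwa [Nat.add_sub_cancel' (Nat.le_mul_of_pos_right _ hn), ← hlen] at this

end ShortChoice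

/-! ### The reduction from Empty to Short Choice. -/

namespace ShortChoice

open Turing Function Polynomial
open Enc (enc)

/-! ### The reduction -/

theorem polyTime_iff {f : List Bool → List Bool} : PolyTime f ↔ PT (α := Str) (β := Str) f := by
  constructor
  · rintro ⟨M⟩
    exact ⟨M.toTM2ComputableAux, M.time, fun a =>
      ⟨(M.outputsFun a).steps, (M.outputsFun a).steps_le_m, (M.outputsFun a).evals_in_steps⟩⟩
  · rintro ⟨M, p, h⟩
    choose t ht h using h
    exact ⟨⟨M, p, fun a => ⟨⟨t a, h a⟩, ht a⟩⟩⟩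

theorem polyTime_of_PT {f : List Bool → List Bool} (hf : PT f) : PolyTime f :=
  polyTime_iff.2 <| PT.comp (g := fun l => Str.ofList (f l)) (by fun_prop) PT.str_toList

theorem PolyTime.comp {f g : List Bool → List Bool} (hf : PolyTime f) (hg : PolyTime g) :
    PolyTime fun x => f (g x) :=
  polyTime_iff.2 <| PT.comp (α := Str) (β := Str) (γ := Str) (polyTime_iff.1 hf) (polyTime_iff.1 hg)

theorem PolyTime.pair {f g : List Bool → List Bool} (hf : PolyTime f) (hg : PolyTime g) :
    PolyTime fun x => pair (f x) (g x) := by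
  obtain ⟨M, p, hM⟩ := PT.prodMk (α := Str) (β := Str) (γ := Str) (f := f) (g := g)
    (polyTime_iff.1 hf) (polyTime_iff.1 hg)
  exact polyTime_iff.2 ⟨M, p, hM⟩

/-- The combined solution map sees only `x` and `y`, so it recomputes the intermediate instance `f
x`. -/
theorem Reduces.trans {R S T : SearchProblem} (h : Reduces R S) (h' : Reduces S T) :
    Reduces R T := by
  obtain ⟨f, g, hf, hg, h⟩ := h
  obtain ⟨f', g', hf', hg', h'⟩ := h'
  have hfst : PolyTime fstStr := polyTime_iff.2 PT.fst_str
  have hsnd : PolyTime sndStr := polyTime_iff.2 PT.snd_str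
  refine ⟨fun x => f' (f x),
    fun z => g (ShortChoice.pair (fstStr z) (g' (ShortChoice.pair (f (fstStr z)) (sndStr z)))),
    hf'.comp hf, hg.comp (hfst.pair (hg'.comp ((hf.comp hfst).pair hsnd))), fun x y hy => ?_⟩
  beta_reduce
  rw [fstStr_pair, sndStr_pair]
  exact h _ _ (h' _ _ hy)

theorem empty_reduces_problem : Reduces Empty Problem := by
  obtain ⟨r, hr⟩ := exists_reads_empty
  have hrc := hr.computable
  have hread : ∀ n C, (r (encEmpty n C)).1 = (n, C) := by
    intro n C
    have := hr.read (n, C) []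
    rw [List.append_nil] at this
    rw [this]
  refine ⟨fun x => encInstance (r x).1.1 (choicePredicates (r x).1.1 (r x).1.2),
    fun z => solution (r (fstStr z)).1.1 (r (fstStr z)).1.2
      (chunks (r (fstStr z)).1.1 (sndStr z).tail) ((sndStr z).headD false),
    polyTime_of_PT (by fun_prop), ?_, ?_⟩
  · have h : PT fun p : List Bool × List Bool => solution (r p.1).1.1 (r p.1).1.2
        (chunks (r p.1).1.1 p.2.tail) (p.2.headD false) := by fun_prop
    have h₁ : PT (α := Str) (β := Str) fun z => Str.ofList (solution (r (fstStr z)).1.1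
        (r (fstStr z)).1.2 (chunks (r (fstStr z)).1.1 (sndStr z).tail) ((sndStr z).headD false)) :=
      PT.str_ofList.comp (h.comp (f := fun z : Str => (Str.toList (fstStr z), Str.toList (sndStr z)))
        (PT.prodMk (PT.str_toList.comp PT.fst_str) (PT.str_toList.comp PT.snd_str)))
    exact polyTime_iff.2 h₁
  -- Only genuine instances of Empty have to be treated; what the parser returns on other strings is
  -- irrelevant.
  · intro x y hy n C hn hC hx
    subst hx
    beta_reduce
    rw [fstStr_pair, sndStr_pair]
    simp only [hread] at hy ⊢
    obtain ⟨as, c, rfl, has⟩ := hy n _ (choicePredicates_isInstance hn hC) rfl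
    have := solution_correct (represents_choicePredicates hn hC) has
    rwa [List.tail_cons, List.headD_cons,
      chunks_flatten (by omega) fun a ha => (has.1.2.1 a ha).1]

end ShortChoice

theorem theorem7 : ShortChoice.PEPPHard ShortChoice.Problem :=
  fun _ hR => ShortChoice.Reduces.trans hR ShortChoice.empty_reduces_problem
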